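/- Let $m=(m_k)_{k\ge 0}$ be a bounded sequence of integers $m_k\ge 2$, and let $G_m=\prod_{k\ge 0}\mathbb{Z}/m_k\mathbb{Z}$ be the corresponding (bounded) Vilenkin group with normalized Haar measure $\mu$. Put $M_0=1$, $M_{k+1}=m_kM_k$, and $|t|=\sum_{k\ge 0}t_k/M_{k+1}$ for $t=(t_k)\in G_m$, $t_k\in\{0,\dots,m_k-1\}$. Write $n=\sum_k n_kM_k$ with $0\le n_k<m_k$, and let $\psi_n(x)=\prod_k \exp(2\pi i\,n_kx_k/m_k)$, $n\ge 0$, be the Vilenkin functions. For $f\in L^1(G_m)$ let $\widehat f(k)=\int_{G_m} f\,\overline{\psi_k}\,d\mu$ and $S_nf=\sum_{k=0}^{n-1}\widehat f(k)\psi_k$ (so $S_0f=0$), and for a sequence $(q_k)_{k\ge0}$ of real numbers let $$T_nf=\frac1{Q_n}\sum_{k=0}^{n-1}q_kS_kf,\qquad Q_n=\sum_{k=0}^{n-1}q_k .$$ For $1\le p<\infty$ and $\alpha>0$, $\mathrm{Lip}(\alpha,p)$ is the set of all $f\in L^p(G_m)$ with $$\omega_p(\delta,f):=\sup_{|t|<\delta}\|f(\cdot-t)-f\|_p=O(\delta^\alpha)\quad\text{as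 }\delta\to0^+ .$$ Let $(q_k)_{k\ge 0}$ be a non-negative and non-increasing sequence with $q_k\asymp(\log k)^{-\beta}$ as $k\to\infty$ for some $\beta>0$, and let $f\in \mathrm{Lip}(\alpha,p)$ for some $\alpha>0$ and $1\le p<\infty$. Then, as $n\to\infty$, $$\|T_nf-f\|_p=\begin{cases}O(n^{-\alpha}), & 0<\alpha<1,\ \beta>0,\\ O(n^{-1}\log n), & \alpha=1,\ 0<\beta<1,\\ O(n^{-1}\log n\,\log\log n), & \alpha=\beta=1,\\ O(n^{-1}(\log n)^{\beta}), & \alpha>1,\ \beta>0.\end{cases}$$ -/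

import Mathlib

open MeasureTheory ProbabilityTheory Filter Asymptotics
open scoped ENNReal Topology

noncomputable section

namespace Vilenkin

/-- The Vilenkin group `G_m`, the complete direct product of the cyclic groups `ℤ/m_kℤ`, with
componentwise addition and the product topology and product σ-algebra. -/
abbrev VilenkinGroup (m : ℕ → ℕ) : Type := (k : ℕ) → ZMod (m k)

/-- The normalized Haar measure of `G_m`: the product of the uniform probability measures on the
factors. -/
def haar (m : ℕ → ℕ) [∀ k, NeZero (m k)] : Measure (VilenkinGroup m) :=
  Measure.infinitePi fun k => uniformOn (Set.univ : Set (ZMod (m k)))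

/-- The generalized powers: `M_0 = 1` and `M_{k+1} = m_k M_k`. -/
def genPow (m : ℕ → ℕ) : ℕ → ℕ
  | 0 => 1
  | k + 1 => m k * genPow m k

/-- The `k`-th digit `n_k` of `n` in the mixed radix system, `n = ∑ n_k M_k` with
`0 ≤ n_k < m_k`. -/
def digit (m : ℕ → ℕ) (n k : ℕ) : ℕ := n / genPow m k % m k

/-- The generalized Rademacher function `r_k(x) = exp(2πi x_k / m_k)`. -/
def rademacher (m : ℕ → ℕ) (k : ℕ) (x : VilenkinGroup m) : ℂ :=
  Complex.exp (2 * Real.pi * Complex.I * ((x k).val : ℂ) / (m k : ℂ))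

/-- The Vilenkin function `ψ_n = ∏_k r_k ^ n_k`. If all `m_k ≥ 2`, then `M_k ≥ 2 ^ k`, so that
`n_k = 0` for all `k ≥ n`, and the product over `k < n` contains all non-trivial factors. -/
def psi (m : ℕ → ℕ) (n : ℕ) (x : VilenkinGroup m) : ℂ :=
  ∏ k ∈ Finset.range n, rademacher m k x ^ digit m n k

/-- The `k`-th Vilenkin–Fourier coefficient of `f`. -/
def fourierCoeff (m : ℕ → ℕ) [∀ k, NeZero (m k)] (f : VilenkinGroup m → ℂ) (k : ℕ) : ℂ :=
  ∫ x, f x * (starRingEnd ℂ) (psi m k x) ∂(haar m)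

/-- The partial sum `S_n f = ∑_{k < n} f^(k) ψ_k`. -/
def partialSum (m : ℕ → ℕ) [∀ k, NeZero (m k)] (n : ℕ) (f : VilenkinGroup m → ℂ)
    (x : VilenkinGroup m) : ℂ :=
  ∑ k ∈ Finset.range n, fourierCoeff m f k * psi m k x

/-- The sums `Q_n = ∑_{k < n} q_k`. -/
def weightSum (q : ℕ → ℝ) (n : ℕ) : ℝ := ∑ k ∈ Finset.range n, q k

/-- The `T` mean `T_n f = (1 / Q_n) ∑_{k < n} q_k S_k f`. -/
def tMean (m : ℕ → ℕ) [∀ k, NeZero (m k)] (q : ℕ → ℝ) (n : ℕ) (f : VilenkinGroup m → ℂ)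
    (x : VilenkinGroup m) : ℂ :=
  ((1 / weightSum q n : ℝ) : ℂ) * ∑ k ∈ Finset.range n, (q k : ℂ) * partialSum m k f x

/-- The usual absolute value `|x| = ∑_k x_k / M_{k+1}` on `G_m`, with `x_k ∈ {0, …, m_k - 1}`. -/
def absVal (m : ℕ → ℕ) (x : VilenkinGroup m) : ℝ :=
  ∑' k, ((x k).val : ℝ) / (genPow m (k + 1) : ℝ)

/-- The modulus of continuity `ω_p(δ, f) = sup_{|t| < δ} ‖f(· - t) - f‖_p`. -/
def modulus (m : ℕ → ℕ) [∀ k, NeZero (m k)] (p : ℝ≥0∞) (δ : ℝ) (f : VilenkinGroup m → ℂ) :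
    ℝ≥0∞ :=
  ⨆ (t : VilenkinGroup m) (_ : absVal m t < δ), eLpNorm (fun x => f (x - t) - f x) p (haar m)

/-- The Lipschitz class `Lip(α, p)`: the functions `f ∈ L^p` such that
`ω_p(δ, f) = O(δ ^ α)` as `δ → 0+`. -/
def MemLip (m : ℕ → ℕ) [∀ k, NeZero (m k)] (α : ℝ) (p : ℝ≥0∞) (f : VilenkinGroup m → ℂ) :
    Prop :=
  MemLp f p (haar m) ∧
    ∃ C : ℝ, ∀ᶠ δ in 𝓝[>] (0 : ℝ), modulus m p δ f ≤ ENNReal.ofReal (C * δ ^ α)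

/-- The approximation error `‖T_n f - f‖_p`. -/
def tError (m : ℕ → ℕ) [∀ k, NeZero (m k)] (q : ℕ → ℝ) (p : ℝ≥0∞) (f : VilenkinGroup m → ℂ)
    (n : ℕ) : ℝ :=
  (eLpNorm (fun x => tMean m q n f x - f x) p (haar m)).toReal

end Vilenkin

end

/-! The Fejér sums `∑_{k < n} D_k` of a bounded Vilenkin group have `L¹`-norm `O(n)`. Since
`D_{M_N} = M_N 1_{I_N}`, the operator `S_{M_N}` averages over the cosets of a ball of radius
`1 / M_N`, so that `‖S_{M_N} f - f‖_p = O(M_N ^ (-α))`. For `M_N ≤ n ≤ M_{N+1}` the operators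
`S_k - 1` with `M_N ≤ k < n` annihilate `S_{M_N} f`, hence `∑_{k < n} (S_k f - f)` grows on this
block by at most `O(M_N) ‖S_{M_N} f - f‖_p = O(M_N ^ (1 - α))`, which is comparable to the growth of
`∑_{k < n} (k + 1) ^ (-α)`. Abel summation transfers this bound to monotone weights:
`Q_n (T_n f - f)` is dominated by `∑_{k < n} q_k (k + 1) ^ (-α)`, and the four rates are those of
the sums of `k ^ (-α) (log k) ^ (-β)`, found by comparison with antiderivatives. -/

section MinkowskiIntegral

variable {X Y : Type*} [MeasurableSpace X] [MeasurableSpace Y] {μ : Measure X} {ν : Measure Y}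

theorem lintegral_rpow_le_measure_univ_rpow_mul {f : Y → ℝ≥0∞} (hf : AEMeasurable f ν) {r : ℝ}
    (hr : 1 ≤ r) : (∫⁻ t, f t ∂ν) ^ r ≤ ν Set.univ ^ (r - 1) * ∫⁻ t, f t ^ r ∂ν := by
  have hr0 : 0 < r := zero_lt_one.trans_le hr
  have holder := eLpNorm'_le_eLpNorm'_mul_rpow_measure_univ one_pos hr hf.aestronglyMeasurable
  simp only [eLpNorm'_eq_lintegral_enorm, enorm_eq_self, ENNReal.rpow_one, one_div, inv_one]
    at holder
  refine (ENNReal.rpow_le_rpow holder hr0.le).trans_eq ?_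
  rw [ENNReal.mul_rpow_of_nonneg _ _ hr0.le, ENNReal.rpow_inv_rpow hr0.ne', ← ENNReal.rpow_mul,
    sub_mul, one_mul, inv_mul_cancel₀ hr0.ne', mul_comm]

variable [SFinite μ] [SFinite ν] {p B : ℝ≥0∞}

theorem ae_ae_le_of_ae_ae_le_swap {F : X × Y → ℝ≥0∞} (hF : AEMeasurable F (μ.prod ν))
    (hB : ∀ᵐ t ∂ν, ∀ᵐ x ∂μ, F (x, t) ≤ B) : ∀ᵐ x ∂μ, ∀ᵐ t ∂ν, F (x, t) ≤ B := by
  have hG : AEMeasurable (fun z => F z - B) (μ.prod ν) := hF.sub_const B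
  have hzero : ∫⁻ x, ∫⁻ t, F (x, t) - B ∂ν ∂μ = 0 := by
    rw [lintegral_lintegral_swap (f := fun x t => F (x, t) - B) hG]
    refine lintegral_eq_zero_of_ae_eq_zero (hB.mono fun t ht => ?_)
    exact lintegral_eq_zero_of_ae_eq_zero (ht.mono fun x hx => tsub_eq_zero_of_le hx)
  filter_upwards [(lintegral_eq_zero_iff' hG.lintegral_prod_right').1 hzero,
    hF.aestronglyMeasurable.prodMk_left] with x hx hFx
  have hx' := (lintegral_eq_zero_iff' (hFx.aemeasurable.sub_const B)).1 hx
  exact hx'.mono fun t ht => tsub_eq_zero_iff_le.1 ht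

theorem eLpNorm_lintegral_le_mul_measure_univ (hp : 1 ≤ p) {F : X × Y → ℝ≥0∞}
    (hF : AEMeasurable F (μ.prod ν)) (hB : ∀ᵐ t ∂ν, eLpNorm (fun x => F (x, t)) p μ ≤ B) :
    eLpNorm (fun x => ∫⁻ t, F (x, t) ∂ν) p μ ≤ B * ν Set.univ := by
  rcases eq_or_ne p ∞ with rfl | hp_top
  · refine eLpNormEssSup_le_of_ae_enorm_bound ?_
    filter_upwards [ae_ae_le_of_ae_ae_le_swap hF (hB.mono fun t ht =>
      (ae_le_eLpNormEssSup (f := fun x => F (x, t))).mono fun x hx => hx.trans ht)] with x hx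
    exact (lintegral_mono_ae hx).trans_eq (lintegral_const B)
  have hp0 : p ≠ 0 := (zero_lt_one.trans_le hp).ne'
  have hr1 : 1 ≤ p.toReal := by simpa using ENNReal.toReal_mono hp_top hp
  have hr0 : 0 < p.toReal := zero_lt_one.trans_le hr1
  rw [eLpNorm_eq_lintegral_rpow_enorm_toReal hp0 hp_top, one_div, ENNReal.rpow_inv_le_iff hr0]
  simp only [enorm_eq_self]
  have hBr : ∀ᵐ t ∂ν, ∫⁻ x, F (x, t) ^ p.toReal ∂μ ≤ B ^ p.toReal := hB.mono fun t ht => by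
    rwa [eLpNorm_eq_lintegral_rpow_enorm_toReal hp0 hp_top, one_div,
      ENNReal.rpow_inv_le_iff hr0] at ht
  calc ∫⁻ x, (∫⁻ t, F (x, t) ∂ν) ^ p.toReal ∂μ
      ≤ ∫⁻ x, ν Set.univ ^ (p.toReal - 1) * ∫⁻ t, F (x, t) ^ p.toReal ∂ν ∂μ :=
        lintegral_mono_ae (hF.aestronglyMeasurable.prodMk_left.mono fun x hx =>
          lintegral_rpow_le_measure_univ_rpow_mul hx.aemeasurable hr1)
    _ = ν Set.univ ^ (p.toReal - 1) * ∫⁻ t, ∫⁻ x, F (x, t) ^ p.toReal ∂μ ∂ν := by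
        rw [lintegral_const_mul'' _ (hF.pow_const _).lintegral_prod_right',
          lintegral_lintegral_swap (f := fun x t => F (x, t) ^ p.toReal) (hF.pow_const _)]
    _ ≤ ν Set.univ ^ (p.toReal - 1) * (B ^ p.toReal * ν Set.univ) := by
        gcongr
        exact (lintegral_mono_ae hBr).trans_eq (lintegral_const _)
    _ = (B * ν Set.univ) ^ p.toReal := by
        rw [ENNReal.mul_rpow_of_nonneg _ _ hr0.le, mul_left_comm]
        nth_rw 2 [← ENNReal.rpow_one (ν Set.univ)]
        rw [← ENNReal.rpow_add_of_nonneg _ _ (sub_nonneg.2 hr1) zero_le_one, sub_add_cancel]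

theorem eLpNorm_integral_smul_le {𝕜 E : Type*} [NormedField 𝕜] [NormedAddCommGroup E]
    [NormedSpace ℝ E] [NormedSpace 𝕜 E] (hp : 1 ≤ p) {H : X × Y → E}
    (hH : AEStronglyMeasurable H (μ.prod ν)) {K : Y → 𝕜} (hK : AEStronglyMeasurable K ν)
    (hB : ∀ t, K t ≠ 0 → eLpNorm (fun x => H (x, t)) p μ ≤ B) :
    eLpNorm (fun x => ∫ t, K t • H (x, t) ∂ν) p μ ≤ B * eLpNorm K 1 ν := by
  set κ := ν.withDensity fun t => ‖K t‖ₑ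
  have hκ : κ ≪ ν := withDensity_absolutelyContinuous _ _
  have hH' : AEMeasurable (fun z => ‖H z‖ₑ) (μ.prod κ) :=
    (hH.mono_ac (Measure.AbsolutelyContinuous.rfl.prod hκ)).enorm
  have huniv : κ Set.univ = eLpNorm K 1 ν := by
    rw [withDensity_apply _ .univ, setLIntegral_univ, eLpNorm_one_eq_lintegral_enorm]
  have hBκ : ∀ᵐ t ∂κ, eLpNorm (fun x => ‖H (x, t)‖ₑ) p μ ≤ B :=
    (ae_withDensity_iff' hK.enorm).2 (ae_of_all _ fun t ht =>
      (eLpNorm_enorm _).trans_le (hB t (enorm_ne_zero.1 ht)))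
  rw [← huniv]
  refine (eLpNorm_mono_enorm_ae ?_).trans (eLpNorm_lintegral_le_mul_measure_univ hp hH' hBκ)
  filter_upwards [hH.prodMk_left] with x hx
  refine (enorm_integral_le_lintegral_enorm _).trans_eq ?_
  rw [enorm_eq_self, lintegral_withDensity_eq_lintegral_mul₀ hK.enorm hx.enorm]
  simp only [enorm_smul, Pi.mul_apply]

end MinkowskiIntegral

theorem map_equiv_uniformOn_univ {Ω : Type*} [Finite Ω] [MeasurableSpace Ω]
    [DiscreteMeasurableSpace Ω] (e : Ω ≃ Ω) :
    (uniformOn (Set.univ : Set Ω)).map e = uniformOn Set.univ := by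
  have := Fintype.ofFinite Ω
  ext s hs
  rw [Measure.map_apply .of_discrete hs, uniformOn_univ, uniformOn_univ,
    Measure.count_apply .of_discrete, Measure.count_apply .of_discrete,
    Set.encard_preimage_of_bijective e.bijective]

theorem eLpNorm_natCast_mul {X 𝕜 : Type*} [MeasurableSpace X] [RCLike 𝕜] {μ : Measure X} (n : ℕ)
    (g : X → 𝕜) (p : ℝ≥0∞) : eLpNorm (fun x => n * g x) p μ = n * eLpNorm g p μ := by
  refine (eLpNorm_const_smul (n : 𝕜) g p μ).trans ?_
  rw [← ofReal_norm, RCLike.norm_natCast, ENNReal.ofReal_natCast]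

theorem integral_addChar_eq_zero {G : Type*} [AddGroup G] [MeasurableSpace G] [MeasurableAdd G]
    {μ : Measure G} [μ.IsAddLeftInvariant] {χ : AddChar G Circle} (hχ : χ ≠ 1) :
    ∫ x, (χ x : ℂ) ∂μ = 0 := by
  obtain ⟨t, ht⟩ := AddChar.ne_one_iff.1 hχ
  have translate : ∫ x, (χ x : ℂ) ∂μ = χ t * ∫ x, (χ x : ℂ) ∂μ := by
    simp only [← integral_const_mul, ← Circle.coe_mul, ← AddChar.map_add_eq_mul,
      integral_add_left_eq_self (fun x => (χ x : ℂ))]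
  by_contra hne
  exact ht (Circle.coe_eq_one.1 (mul_right_cancel₀ hne (by rw [one_mul, ← translate])))

namespace Vilenkin

section Haar

variable {m : ℕ → ℕ} [∀ k, NeZero (m k)]

instance isProbabilityMeasure_uniformOn_zmod (k : ℕ) :
    IsProbabilityMeasure (uniformOn (Set.univ : Set (ZMod (m k)))) :=
  isProbabilityMeasure_uniformOn Set.finite_univ Set.univ_nonempty

instance isProbabilityMeasure_haar : IsProbabilityMeasure (haar m) := by
  unfold haar; infer_instance

theorem map_haar_of_equiv (e : ∀ k, ZMod (m k) ≃ ZMod (m k)) :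
    (haar m).map (fun x k => e k (x k)) = haar m := by
  unfold haar
  rw [Measure.infinitePi_map_pi (f := fun k => e k) _ fun k => .of_discrete]
  simp_rw [map_equiv_uniformOn_univ]

instance isAddLeftInvariant_haar : (haar m).IsAddLeftInvariant :=
  ⟨fun g => map_haar_of_equiv fun k => Equiv.addLeft (g k)⟩

instance isNegInvariant_haar : (haar m).IsNegInvariant :=
  ⟨map_haar_of_equiv fun _ => Equiv.neg _⟩

end Haar

section Digits

variable {m : ℕ → ℕ}

theorem genPow_succ (k : ℕ) : genPow m (k + 1) = m k * genPow m k := rfl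

theorem genPow_dvd {k l : ℕ} (h : k ≤ l) : genPow m k ∣ genPow m l := by
  induction l, h using Nat.le_induction with
  | base => rfl
  | succ l _ ih => exact ih.trans (Dvd.intro_left _ rfl)

theorem lt_genPow (hm : ∀ k, 2 ≤ m k) (k : ℕ) : k < genPow m k := by
  induction k with
  | zero => exact one_pos
  | succ k ih =>
    rw [genPow_succ]
    have := Nat.mul_le_mul_right (genPow m k) (hm k)
    omega

theorem mul_genPow_add_lt {N j i : ℕ} (hj : j < m N) (hi : i < genPow m N) :
    j * genPow m N + i < genPow m (N + 1) := by
  rw [genPow_succ]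
  have := Nat.mul_le_mul_right (genPow m N) (Nat.succ_le_of_lt hj)
  rw [Nat.succ_mul] at this
  omega

theorem exists_genPow_le_lt (hm : ∀ k, 2 ≤ m k) {n : ℕ} (hn : 0 < n) :
    ∃ N, genPow m N ≤ n ∧ n < genPow m (N + 1) := by
  have zero_spec : genPow m 0 ≤ n := hn
  refine ⟨Nat.findGreatest (genPow m · ≤ n) n,
    Nat.findGreatest_spec (P := (genPow m · ≤ n)) n.zero_le zero_spec, ?_⟩
  by_contra! h
  exact Nat.findGreatest_is_greatest (P := (genPow m · ≤ n)) (Nat.lt_succ_self _)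
    ((lt_genPow hm _).le.trans h) h

theorem digit_eq_zero {n k : ℕ} (h : n < genPow m k) : digit m n k = 0 := by
  rw [digit, Nat.div_eq_of_lt h, Nat.zero_mod]

theorem eq_of_digit_eq (hm : ∀ k, 2 ≤ m k) {i j : ℕ} (h : ∀ k, digit m i k = digit m j k) :
    i = j := by
  have mod_eq : ∀ k, i % genPow m k = j % genPow m k := fun k => by
    induction k with
    | zero => simp only [genPow, Nat.mod_one]
    | succ k ih =>
      rw [genPow_succ, mul_comm, Nat.mod_mul, Nat.mod_mul, ih]
      exact congrArg (j % genPow m k + genPow m k * ·) (h k)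
  have hlt := lt_genPow hm (i + j)
  simpa only [Nat.mod_eq_of_lt ((i.le_add_right j).trans_lt hlt),
    Nat.mod_eq_of_lt ((j.le_add_left i).trans_lt hlt)] using mod_eq (i + j)

variable [∀ k, NeZero (m k)]

theorem genPow_pos (k : ℕ) : 0 < genPow m k := by
  induction k with
  | zero => exact one_pos
  | succ k ih => exact Nat.mul_pos (NeZero.pos _) ih

theorem genPow_mono {k l : ℕ} (h : k ≤ l) : genPow m k ≤ genPow m l :=
  Nat.le_of_dvd (genPow_pos l) (genPow_dvd h)

theorem digit_mul_add_of_lt {N k : ℕ} (h : k < N) (j i : ℕ) :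
    digit m (j * genPow m N + i) k = digit m i k := by
  obtain ⟨c, hc⟩ := genPow_dvd (m := m) (Nat.succ_le_of_lt h)
  have split : j * genPow m N + i = i + (j * c * m k) * genPow m k := by
    rw [hc, Nat.succ_eq_add_one, genPow_succ]; ring
  rw [digit, split, Nat.add_mul_div_right _ _ (genPow_pos k), Nat.add_mul_mod_self_right, digit]

theorem digit_mul_add_self {N j i : ℕ} (hj : j < m N) (hi : i < genPow m N) :
    digit m (j * genPow m N + i) N = j := by
  rw [digit, add_comm, Nat.add_mul_div_right _ _ (genPow_pos N), Nat.div_eq_of_lt hi, zero_add,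
    Nat.mod_eq_of_lt hj]

end Digits

section Characters

variable {m : ℕ → ℕ}

theorem psi_zero (x : VilenkinGroup m) : psi m 0 x = 1 := Finset.prod_range_zero _

variable [∀ k, NeZero (m k)]

variable (m) in
/-- The Vilenkin function `ψ_n` as a character of `G_m`, so that its multiplicativity and
unimodularity come with its type. -/
noncomputable def psiChar (n : ℕ) : AddChar (VilenkinGroup m) Circle :=
  ∏ k ∈ Finset.range n,
    ZMod.toCircle.compAddMonoidHom (Pi.evalAddMonoidHom (fun k => ZMod (m k)) k) ^ digit m n k

theorem rademacher_eq_stdAddChar (k : ℕ) (x : VilenkinGroup m) :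
    rademacher m k x = ZMod.stdAddChar (x k) := by
  rw [ZMod.stdAddChar_apply, ZMod.toCircle_apply, rademacher]

theorem coe_psiChar (n : ℕ) (x : VilenkinGroup m) : (psiChar m n x : ℂ) = psi m n x := by
  simp only [psiChar, psi, rademacher_eq_stdAddChar, AddChar.prod_apply, AddChar.pow_apply,
    ZMod.stdAddChar_apply]
  exact (map_prod Circle.coeHom _ _).trans (Finset.prod_congr rfl fun k _ => Circle.coe_pow _ _)

theorem norm_rademacher (k : ℕ) (x : VilenkinGroup m) : ‖rademacher m k x‖ = 1 := by
  rw [rademacher_eq_stdAddChar, ZMod.stdAddChar_apply, Circle.norm_coe]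

theorem measurable_rademacher (k : ℕ) : Measurable (rademacher m k) := by
  rw [funext (rademacher_eq_stdAddChar k)]
  exact Measurable.of_discrete.comp (measurable_pi_apply k)

theorem sum_rademacher_pow (k : ℕ) (x : VilenkinGroup m) :
    ∑ j ∈ Finset.range (m k), rademacher m k x ^ j = if x k = 0 then (m k : ℂ) else 0 := by
  rw [rademacher_eq_stdAddChar]
  split_ifs with h
  · simp [h]
  · have ne_one : ZMod.stdAddChar (x k) ≠ 1 := fun h1 =>
      h (ZMod.injective_stdAddChar (h1.trans (AddChar.map_zero_eq_one _).symm))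
    rw [geom_sum_eq ne_one, ← AddChar.map_nsmul_eq_pow, nsmul_eq_mul, ZMod.natCast_self, zero_mul,
      AddChar.map_zero_eq_one, sub_self, zero_div]

theorem norm_psi (n : ℕ) (x : VilenkinGroup m) : ‖psi m n x‖ = 1 := by
  rw [← coe_psiChar, Circle.norm_coe]

theorem psi_sub (n : ℕ) (x y : VilenkinGroup m) :
    psi m n (x - y) = psi m n x * (starRingEnd ℂ) (psi m n y) := by
  simp only [← coe_psiChar, AddChar.map_sub_eq_div, ← Circle.coe_inv_eq_conj, div_eq_mul_inv,
    Circle.coe_mul]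

theorem measurable_psi (n : ℕ) : Measurable (psi m n) :=
  Finset.measurable_prod _ fun k _ => (measurable_rademacher k).pow_const _

theorem psi_eq_prod {n L : ℕ} (hm : ∀ k, 2 ≤ m k) (h : n < genPow m L) (x : VilenkinGroup m) :
    psi m n x = ∏ k ∈ Finset.range L, rademacher m k x ^ digit m n k := by
  have prod_eq : ∀ {a b : ℕ}, a ≤ b → n < genPow m a →
      ∏ k ∈ Finset.range a, rademacher m k x ^ digit m n k =
        ∏ k ∈ Finset.range b, rademacher m k x ^ digit m n k := fun hab ha =>
    Finset.prod_subset (Finset.range_mono hab) fun k _ hk => by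
      rw [digit_eq_zero (ha.trans_le (genPow_mono (by simpa using hk))), pow_zero]
  rcases le_total n L with hnL | hnL
  · exact prod_eq hnL (lt_genPow hm n)
  · exact (prod_eq hnL h).symm

theorem psi_mul_add (hm : ∀ k, 2 ≤ m k) {N j i : ℕ} (hj : j < m N) (hi : i < genPow m N)
    (x : VilenkinGroup m) :
    psi m (j * genPow m N + i) x = rademacher m N x ^ j * psi m i x := by
  rw [psi_eq_prod hm (mul_genPow_add_lt hj hi), Finset.prod_range_succ, digit_mul_add_self hj hi,
    psi_eq_prod hm hi, mul_comm]
  congr 1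
  exact Finset.prod_congr rfl fun k hk => by rw [digit_mul_add_of_lt (Finset.mem_range.1 hk)]

theorem dependsOn_psi (hm : ∀ k, 2 ≤ m k) {n N : ℕ} (hn : n < genPow m N) :
    DependsOn (psi m n) (Set.Iio N) := fun x y h => by
  rw [psi_eq_prod hm hn, psi_eq_prod hm hn]
  refine Finset.prod_congr rfl fun k hk => ?_
  rw [rademacher_eq_stdAddChar, rademacher_eq_stdAddChar, h k (Finset.mem_range.1 hk)]

theorem psi_single (hm : ∀ k, 2 ≤ m k) (n k : ℕ) :
    psi m n (Pi.single k 1) = ZMod.stdAddChar (digit m n k : ZMod (m k)) := by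
  rw [psi_eq_prod (L := n + k + 1) hm ((lt_genPow hm n).trans_le (genPow_mono (by omega))),
    Finset.prod_eq_single k]
  · rw [rademacher_eq_stdAddChar, ← AddChar.map_nsmul_eq_pow, Pi.single_eq_same, nsmul_one]
  · intro l _ hl
    rw [rademacher_eq_stdAddChar, Pi.single_eq_of_ne hl, AddChar.map_zero_eq_one, one_pow]
  · exact fun h => absurd (Finset.mem_range.2 (by omega)) h

theorem psiChar_injective (hm : ∀ k, 2 ≤ m k) : Function.Injective (psiChar m) := by
  refine fun i j hij => eq_of_digit_eq hm fun k => ?_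
  have h : psi m i (Pi.single k 1) = psi m j (Pi.single k 1) := by
    rw [← coe_psiChar, hij, coe_psiChar]
  rw [psi_single hm, psi_single hm] at h
  simpa only [digit, ZMod.natCast_eq_natCast_iff', Nat.mod_mod] using ZMod.injective_stdAddChar h

theorem fourierCoeff_psi (hm : ∀ k, 2 ≤ m k) (i j : ℕ) :
    fourierCoeff m (psi m i) j = if i = j then 1 else 0 := by
  have coe_div : ∀ x, psi m i x * (starRingEnd ℂ) (psi m j x) =
      ((psiChar m i / psiChar m j) x : ℂ) := fun x => by
    rw [AddChar.div_apply', div_eq_mul_inv, Circle.coe_mul, Circle.coe_inv_eq_conj, coe_psiChar,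
      coe_psiChar]
  simp only [fourierCoeff, coe_div]
  split_ifs with hij
  · simp [hij]
  · exact integral_addChar_eq_zero (div_ne_one.2 ((psiChar_injective hm).ne hij))

end Characters

section Kernels

variable {m : ℕ → ℕ}

variable (m) in
/-- The Dirichlet kernel `D_n = ∑_{k < n} ψ_k`; convolution with it is `S_n`. -/
noncomputable def dirichletKernel (n : ℕ) (x : VilenkinGroup m) : ℂ :=
  ∑ k ∈ Finset.range n, psi m k x

variable (m) in
/-- The sum `∑_{k < n} D_k`, that is, the Fejér kernel without the normalizing factor `1 / n`. -/
noncomputable def fejerSum (n : ℕ) (x : VilenkinGroup m) : ℂ :=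
  ∑ k ∈ Finset.range n, dirichletKernel m k x

variable [∀ k, NeZero (m k)]

theorem measurable_dirichletKernel (n : ℕ) : Measurable (dirichletKernel m n) :=
  Finset.measurable_sum _ fun k _ => measurable_psi k

theorem measurable_fejerSum (n : ℕ) : Measurable (fejerSum m n) :=
  Finset.measurable_sum _ fun k _ => measurable_dirichletKernel k

theorem norm_dirichletKernel_le (n : ℕ) (x : VilenkinGroup m) : ‖dirichletKernel m n x‖ ≤ n :=
  (norm_sum_le _ _).trans (by simp [norm_psi])

theorem dependsOn_dirichletKernel (hm : ∀ k, 2 ≤ m k) (N : ℕ) :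
    DependsOn (dirichletKernel m (genPow m N)) (Set.Iio N) := fun _ _ h =>
  Finset.sum_congr rfl fun _ hk => dependsOn_psi hm (Finset.mem_range.1 hk) h

theorem dependsOn_fejerSum (hm : ∀ k, 2 ≤ m k) (N : ℕ) :
    DependsOn (fejerSum m (genPow m N)) (Set.Iio N) := fun _ _ h =>
  Finset.sum_congr rfl fun _ hk => Finset.sum_congr rfl fun _ hl =>
    dependsOn_psi hm ((Finset.mem_range.1 hl).trans (Finset.mem_range.1 hk)) h

theorem dirichletKernel_mul_add (hm : ∀ k, 2 ≤ m k) {N j i : ℕ} (hj : j < m N)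
    (hi : i ≤ genPow m N) (x : VilenkinGroup m) :
    dirichletKernel m (j * genPow m N + i) x =
      dirichletKernel m (j * genPow m N) x + rademacher m N x ^ j * dirichletKernel m i x := by
  simp only [dirichletKernel, Finset.sum_range_add, Finset.mul_sum]
  congr 1
  exact Finset.sum_congr rfl fun k hk => psi_mul_add hm hj ((Finset.mem_range.1 hk).trans_le hi) x

theorem dirichletKernel_mul (hm : ∀ k, 2 ≤ m k) {N j : ℕ} (hj : j ≤ m N) (x : VilenkinGroup m) :
    dirichletKernel m (j * genPow m N) x =
      (∑ i ∈ Finset.range j, rademacher m N x ^ i) * dirichletKernel m (genPow m N) x := by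
  induction j with
  | zero => simp [dirichletKernel]
  | succ j ih =>
    rw [Nat.succ_mul, dirichletKernel_mul_add hm hj le_rfl, ih (by omega), Finset.sum_range_succ,
      add_mul]

theorem fejerSum_mul_add (hm : ∀ k, 2 ≤ m k) {N j i : ℕ} (hj : j < m N)
    (hi : i ≤ genPow m N) (x : VilenkinGroup m) :
    fejerSum m (j * genPow m N + i) x = fejerSum m (j * genPow m N) x +
      (i * dirichletKernel m (j * genPow m N) x + rademacher m N x ^ j * fejerSum m i x) := by
  have expand : ∀ k ∈ Finset.range i, dirichletKernel m (j * genPow m N + k) x =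
      dirichletKernel m (j * genPow m N) x + rademacher m N x ^ j * dirichletKernel m k x :=
    fun k hk => dirichletKernel_mul_add hm hj ((Finset.mem_range.1 hk).le.trans hi) x
  simp only [fejerSum, Finset.sum_range_add, Finset.mul_sum]
  rw [Finset.sum_congr rfl expand, Finset.sum_add_distrib, Finset.sum_const, Finset.card_range,
    nsmul_eq_mul]

theorem fejerSum_mul (hm : ∀ k, 2 ≤ m k) {N j : ℕ} (hj : j ≤ m N) (x : VilenkinGroup m) :
    fejerSum m (j * genPow m N) x =
      genPow m N * ∑ i ∈ Finset.range j, dirichletKernel m (i * genPow m N) x +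
      (∑ i ∈ Finset.range j, rademacher m N x ^ i) * fejerSum m (genPow m N) x := by
  induction j with
  | zero => simp [fejerSum]
  | succ j ih =>
    rw [Nat.succ_mul, fejerSum_mul_add hm hj le_rfl, ih (by omega), Finset.sum_range_succ,
      Finset.sum_range_succ]
    ring

theorem mul_lintegral_mul_of_dependsOn {N : ℕ} (φ : ZMod (m N) → ℝ≥0∞)
    {g : VilenkinGroup m → ℝ≥0∞} (hg : Measurable g) (hgN : DependsOn g {N}ᶜ) :
    m N * ∫⁻ x, φ (x N) * g x ∂haar m = (∑ a, φ a) * ∫⁻ x, g x ∂haar m := by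
  have translate : ∀ (a : ZMod (m N)) (x : VilenkinGroup m),
      φ ((Pi.single N a + x : VilenkinGroup m) N) * g (Pi.single N a + x) = φ (a + x N) * g x :=
      fun a x => by
    have hgx : g (Pi.single N a + x) = g x := hgN fun k hk => by
      rw [Pi.add_apply, Pi.single_eq_of_ne hk, zero_add]
    rw [hgx, Pi.add_apply, Pi.single_eq_same]
  calc m N * ∫⁻ x, φ (x N) * g x ∂haar m
      = ∑ _ : ZMod (m N), ∫⁻ x, φ (x N) * g x ∂haar m := by simp
    _ = ∑ a : ZMod (m N), ∫⁻ x, φ (a + x N) * g x ∂haar m := by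
        simp_rw [← translate]
        exact Finset.sum_congr rfl fun a _ => (lintegral_add_left_eq_self _ _).symm
    _ = ∫⁻ x, (∑ a, φ a) * g x ∂haar m := by
        rw [← lintegral_finsetSum]
        · refine lintegral_congr fun x => ?_
          rw [← Finset.sum_mul]
          exact congrArg (· * g x) (Equiv.sum_comp (Equiv.addRight (x N)) φ)
        · exact fun a _ => (Measurable.of_discrete (f := fun b => φ (a + b)) |>.comp
            (measurable_pi_apply N)).mul hg
    _ = (∑ a, φ a) * ∫⁻ x, g x ∂haar m := lintegral_const_mul _ hg

theorem eLpNorm_sum_rademacher_mul {N : ℕ} {K : VilenkinGroup m → ℂ} (hK : Measurable K)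
    (hKN : DependsOn K (Set.Iio N)) :
    eLpNorm (fun x => (∑ j ∈ Finset.range (m N), rademacher m N x ^ j) * K x) 1 (haar m) =
      eLpNorm K 1 (haar m) := by
  set φ : ZMod (m N) → ℝ≥0∞ := fun a => ‖if a = 0 then (m N : ℂ) else 0‖ₑ
  have hφ : ∑ a, φ a = m N := by
    rw [Finset.sum_eq_single 0 (fun a _ ha => by simp [φ, ha]) (by simp)]
    simp [φ, ← ofReal_norm]
  have hgN : DependsOn (fun x => ‖K x‖ₑ) {N}ᶜ := fun x y h =>
    congrArg _ (hKN fun k hk => h k (Set.mem_Iio.1 hk).ne)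
  refine (ENNReal.mul_right_inj (by simp [NeZero.ne]) (ENNReal.natCast_ne_top (m N))).1 ?_
  simp only [eLpNorm_one_eq_lintegral_enorm, sum_rademacher_pow, enorm_mul]
  exact (mul_lintegral_mul_of_dependsOn φ hK.enorm hgN).trans (by rw [hφ])

theorem eLpNorm_rademacher_pow_mul (N j : ℕ) (K : VilenkinGroup m → ℂ) :
    eLpNorm (fun x => rademacher m N x ^ j * K x) 1 (haar m) = eLpNorm K 1 (haar m) :=
  eLpNorm_congr_norm_ae (ae_of_all _ fun x => by
    rw [norm_mul, norm_pow, norm_rademacher, one_pow, one_mul])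

theorem eLpNorm_geom_sum_rademacher_mul_le (N j : ℕ) (K : VilenkinGroup m → ℂ) :
    eLpNorm (fun x => (∑ i ∈ Finset.range j, rademacher m N x ^ i) * K x) 1 (haar m) ≤
      j * eLpNorm K 1 (haar m) := by
  rw [← ENNReal.ofReal_natCast]
  refine eLpNorm_le_mul_eLpNorm_of_ae_le_mul (ae_of_all _ fun x => ?_) 1
  rw [norm_mul]
  gcongr
  exact (norm_sum_le _ _).trans (by simp [norm_rademacher])

theorem eLpNorm_dirichletKernel_genPow (hm : ∀ k, 2 ≤ m k) (N : ℕ) :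
    eLpNorm (dirichletKernel m (genPow m N)) 1 (haar m) = 1 := by
  induction N with
  | zero => simp [eLpNorm_one_eq_lintegral_enorm, genPow, dirichletKernel, psi_zero]
  | succ N ih =>
    rw [genPow_succ, funext (dirichletKernel_mul hm le_rfl), eLpNorm_sum_rademacher_mul
      (measurable_dirichletKernel _) (dependsOn_dirichletKernel hm N), ih]

theorem eLpNorm_dirichletKernel_mul_le (hm : ∀ k, 2 ≤ m k) {N j : ℕ} (hj : j ≤ m N) :
    eLpNorm (dirichletKernel m (j * genPow m N)) 1 (haar m) ≤ j := by
  rw [funext (dirichletKernel_mul hm hj)]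
  refine (eLpNorm_geom_sum_rademacher_mul_le N j _).trans_eq ?_
  rw [eLpNorm_dirichletKernel_genPow hm, mul_one]

theorem eLpNorm_fejerSum_mul_le_add (hm : ∀ k, 2 ≤ m k) {N j A : ℕ} (hj : j ≤ m N)
    (hA : m N ≤ A) :
    eLpNorm (fejerSum m (j * genPow m N)) 1 (haar m) ≤ A * (j * genPow m N) +
      eLpNorm (fun x => (∑ i ∈ Finset.range j, rademacher m N x ^ i) * fejerSum m (genPow m N) x)
        1 (haar m) := by
  have hD := measurable_dirichletKernel (m := m)
  have hF := measurable_fejerSum (m := m)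
  have hr := measurable_rademacher (m := m)
  have hsum : eLpNorm (fun x => ∑ i ∈ Finset.range j, dirichletKernel m (i * genPow m N) x)
      1 (haar m) ≤ j * A := by
    calc _ = eLpNorm (∑ i ∈ Finset.range j, dirichletKernel m (i * genPow m N)) 1 (haar m) := by
          rw [Finset.sum_fn]
      _ ≤ ∑ i ∈ Finset.range j, eLpNorm (dirichletKernel m (i * genPow m N)) 1 (haar m) :=
          eLpNorm_sum_le (fun i _ => (hD _).aestronglyMeasurable) le_rfl
      _ ≤ ∑ _ ∈ Finset.range j, (A : ℝ≥0∞) := Finset.sum_le_sum fun i hi => by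
          have hij : i ≤ m N := (Finset.mem_range.1 hi).le.trans hj
          exact (eLpNorm_dirichletKernel_mul_le hm hij).trans (by exact_mod_cast hij.trans hA)
      _ = j * A := by rw [Finset.sum_const, Finset.card_range, nsmul_eq_mul]
  rw [funext (fejerSum_mul hm hj)]
  refine (eLpNorm_add_le (Measurable.aestronglyMeasurable (by fun_prop))
    (Measurable.aestronglyMeasurable (by fun_prop)) le_rfl).trans (add_le_add_left ?_ _)
  rw [eLpNorm_natCast_mul]
  exact (mul_le_mul_right hsum _).trans_eq (by ring)

theorem eLpNorm_fejerSum_genPow_le (hm : ∀ k, 2 ≤ m k) {A : ℕ} (hA : ∀ k, m k ≤ A) (N : ℕ) :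
    eLpNorm (fejerSum m (genPow m N)) 1 (haar m) ≤ 2 * A * genPow m N := by
  induction N with
  | zero => simp [eLpNorm_one_eq_lintegral_enorm, genPow, fejerSum, dirichletKernel]
  | succ N ih =>
    have hfirst := eLpNorm_fejerSum_mul_le_add hm le_rfl (hA N)
    rw [eLpNorm_sum_rademacher_mul (measurable_fejerSum _) (dependsOn_fejerSum hm N)] at hfirst
    refine (hfirst.trans (add_le_add_right ih _)).trans ?_
    have h := Nat.mul_le_mul_left A (Nat.mul_le_mul_right (genPow m N) (hm N))
    rw [genPow_succ]
    exact_mod_cast (by linarith : A * (m N * genPow m N) + 2 * A * genPow m N ≤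
      2 * A * (m N * genPow m N))

theorem eLpNorm_fejerSum_mul_le (hm : ∀ k, 2 ≤ m k) {A : ℕ} (hA : ∀ k, m k ≤ A) {N j : ℕ}
    (hj : j ≤ m N) :
    eLpNorm (fejerSum m (j * genPow m N)) 1 (haar m) ≤ 3 * A * (j * genPow m N) := by
  calc _ ≤ A * (j * genPow m N) + j * (2 * A * genPow m N : ℝ≥0∞) := by
        refine (eLpNorm_fejerSum_mul_le_add hm hj (hA N)).trans (add_le_add_right ?_ _)
        exact (eLpNorm_geom_sum_rademacher_mul_le N j _).trans
          (mul_le_mul_right (eLpNorm_fejerSum_genPow_le hm hA N) _)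
    _ = 3 * A * (j * genPow m N) := by ring

theorem eLpNorm_fejerSum_le (hm : ∀ k, 2 ≤ m k) {A : ℕ} (hA : ∀ k, m k ≤ A) (n : ℕ) :
    eLpNorm (fejerSum m n) 1 (haar m) ≤ 4 * A * n := by
  have hD := measurable_dirichletKernel (m := m)
  have hF := measurable_fejerSum (m := m)
  have hr := measurable_rademacher (m := m)
  suffices ∀ N n, n < genPow m N → eLpNorm (fejerSum m n) 1 (haar m) ≤ 4 * A * n from
    this n n (lt_genPow hm n)
  intro N
  induction N with
  | zero =>
    intro n hn
    obtain rfl : n = 0 := Nat.lt_one_iff.1 hn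
    simp [eLpNorm_one_eq_lintegral_enorm, fejerSum]
  | succ N ih =>
    intro n hn
    obtain ⟨j, i, hj, hi, rfl⟩ : ∃ j i, j < m N ∧ i < genPow m N ∧ n = j * genPow m N + i :=
      ⟨n / genPow m N, n % genPow m N, Nat.div_lt_of_lt_mul (by rwa [mul_comm, ← genPow_succ]),
        Nat.mod_lt _ (genPow_pos N), (Nat.div_add_mod' _ _).symm⟩
    calc eLpNorm (fejerSum m (j * genPow m N + i)) 1 (haar m)
        ≤ eLpNorm (fejerSum m (j * genPow m N)) 1 (haar m) +
          (i * eLpNorm (dirichletKernel m (j * genPow m N)) 1 (haar m) +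
            eLpNorm (fejerSum m i) 1 (haar m)) := by
          rw [funext (fejerSum_mul_add hm hj hi.le), ← eLpNorm_natCast_mul,
            ← eLpNorm_rademacher_pow_mul N j (fejerSum m i)]
          refine (eLpNorm_add_le (hF _).aestronglyMeasurable
            (Measurable.aestronglyMeasurable (by fun_prop)) le_rfl).trans (add_le_add_right ?_ _)
          exact eLpNorm_add_le (Measurable.aestronglyMeasurable (by fun_prop))
            (Measurable.aestronglyMeasurable (by fun_prop)) le_rfl
      _ ≤ 3 * A * (j * genPow m N) + (i * j + 4 * A * i) := by
          gcongr
          exacts [eLpNorm_fejerSum_mul_le hm hA hj.le, eLpNorm_dirichletKernel_mul_le hm hj.le,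
            ih i hi]
      _ ≤ 4 * A * ((j * genPow m N + i : ℕ) : ℝ≥0∞) := by
          have hA1 : 1 ≤ A := one_le_two.trans ((hm 0).trans (hA 0))
          have h := Nat.mul_le_mul hA1 (Nat.mul_le_mul_left j hi.le)
          exact_mod_cast (by linarith : 3 * A * (j * genPow m N) + (i * j + 4 * A * i) ≤
            4 * A * (j * genPow m N + i))

end Kernels

section PartialSums

variable {m : ℕ → ℕ} [∀ k, NeZero (m k)]

theorem memLp_psi (n : ℕ) (p : ℝ≥0∞) : MemLp (psi m n) p (haar m) :=
  MemLp.of_bound (measurable_psi n).aestronglyMeasurable 1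
    (ae_of_all _ fun x => (norm_psi n x).le)

theorem memLp_partialSum (n : ℕ) (g : VilenkinGroup m → ℂ) (p : ℝ≥0∞) :
    MemLp (partialSum m n g) p (haar m) :=
  memLp_finsetSum (Finset.range n) fun k _ => (memLp_psi k p).const_mul (fourierCoeff m g k)

theorem integrable_mul_conj_psi {g : VilenkinGroup m → ℂ} (hg : Integrable g (haar m)) (n : ℕ) :
    Integrable (fun x => g x * (starRingEnd ℂ) (psi m n x)) (haar m) :=
  hg.mul_bdd (c := 1) (Complex.continuous_conj.measurable.comp
    (measurable_psi n)).aestronglyMeasurable (ae_of_all _ fun x => by simp [norm_psi])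

theorem integrable_dirichletKernel_mul {g : VilenkinGroup m → ℂ} (hg : Integrable g (haar m))
    (n : ℕ) : Integrable (fun t => dirichletKernel m n t * g t) (haar m) :=
  hg.bdd_mul (measurable_dirichletKernel n).aestronglyMeasurable
    (ae_of_all _ (norm_dirichletKernel_le n))

theorem partialSum_eq_integral {g : VilenkinGroup m → ℂ} (hg : Integrable g (haar m)) (n : ℕ)
    (x : VilenkinGroup m) :
    partialSum m n g x = ∫ t, dirichletKernel m n t * g (x - t) ∂haar m := by
  have hpsi : ∀ k t, psi m k (x - t) * g t =
      (g t * (starRingEnd ℂ) (psi m k t)) * psi m k x := fun k t => by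
    rw [psi_sub]
    ring
  rw [← integral_sub_left_eq_self (fun t => dirichletKernel m n t * g (x - t)) (haar m) x]
  simp only [sub_sub_cancel, dirichletKernel, Finset.sum_mul, hpsi]
  rw [integral_finsetSum _ fun k _ => (integrable_mul_conj_psi hg k).mul_const _]
  simp only [integral_mul_const, partialSum, fourierCoeff]

theorem sum_partialSum_eq_integral {g : VilenkinGroup m → ℂ} (hg : Integrable g (haar m)) (n : ℕ)
    (x : VilenkinGroup m) :
    ∑ k ∈ Finset.range n, partialSum m k g x = ∫ t, fejerSum m n t * g (x - t) ∂haar m := by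
  simp only [fejerSum, Finset.sum_mul]
  rw [integral_finsetSum _ fun k _ => integrable_dirichletKernel_mul (hg.comp_sub_left x) k]
  simp only [partialSum_eq_integral hg]

theorem aestronglyMeasurable_comp_sub {g : VilenkinGroup m → ℂ}
    (hg : AEStronglyMeasurable g (haar m)) :
    AEStronglyMeasurable (fun z : VilenkinGroup m × VilenkinGroup m => g (z.1 - z.2))
      ((haar m).prod (haar m)) :=
  hg.comp_quasiMeasurePreserving (quasiMeasurePreserving_sub_of_right_invariant _ _)

theorem eLpNorm_sum_partialSum_le (hm : ∀ k, 2 ≤ m k) {A : ℕ} (hA : ∀ k, m k ≤ A) {p : ℝ≥0∞}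
    (hp : 1 ≤ p) {g : VilenkinGroup m → ℂ} (hg : MemLp g p (haar m)) (n : ℕ) :
    eLpNorm (fun x => ∑ k ∈ Finset.range n, partialSum m k g x) p (haar m) ≤
      4 * A * n * eLpNorm g p (haar m) := by
  have htranslate : ∀ t, eLpNorm (fun x => g (x - t)) p (haar m) ≤ eLpNorm g p (haar m) := fun t =>
    (eLpNorm_comp_measurePreserving hg.1 (measurePreserving_sub_right (haar m) t)).le
  rw [funext (sum_partialSum_eq_integral (hg.integrable hp) n), mul_comm]
  exact (eLpNorm_integral_smul_le hp (aestronglyMeasurable_comp_sub hg.1)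
    (measurable_fejerSum n).aestronglyMeasurable fun t _ => htranslate t).trans
    (mul_le_mul_right (eLpNorm_fejerSum_le hm hA n) _)

theorem partialSum_sub {g h : VilenkinGroup m → ℂ} (hg : Integrable g (haar m))
    (hh : Integrable h (haar m)) (n : ℕ) (x : VilenkinGroup m) :
    partialSum m n (fun y => g y - h y) x = partialSum m n g x - partialSum m n h x := by
  have hcoeff : ∀ k, fourierCoeff m (fun y => g y - h y) k =
      fourierCoeff m g k - fourierCoeff m h k := fun k => by
    simp only [fourierCoeff, sub_mul]
    exact integral_sub (integrable_mul_conj_psi hg k) (integrable_mul_conj_psi hh k)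
  simp only [partialSum, hcoeff, sub_mul, Finset.sum_sub_distrib]

theorem fourierCoeff_partialSum (hm : ∀ k, 2 ≤ m k) (n : ℕ) (g : VilenkinGroup m → ℂ) (j : ℕ) :
    fourierCoeff m (partialSum m n g) j = if j < n then fourierCoeff m g j else 0 := by
  calc fourierCoeff m (partialSum m n g) j
      = ∑ k ∈ Finset.range n, fourierCoeff m g k * fourierCoeff m (psi m k) j := by
        simp only [fourierCoeff, partialSum, Finset.sum_mul, mul_assoc]
        rw [integral_finsetSum _ fun k _ => (integrable_mul_conj_psi
          ((memLp_psi k 1).integrable le_rfl) j).const_mul _]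
        simp only [integral_const_mul]
    _ = if j < n then fourierCoeff m g j else 0 := by simp [fourierCoeff_psi hm]

theorem partialSum_partialSum (hm : ∀ k, 2 ≤ m k) (k n : ℕ) (g : VilenkinGroup m → ℂ) :
    partialSum m k (partialSum m n g) = partialSum m (min k n) g := by
  funext x
  have hrange : {j ∈ Finset.range k | j < n} = Finset.range (min k n) := by
    ext j
    simp
  simp only [partialSum, ← hrange, Finset.sum_filter]
  refine Finset.sum_congr rfl fun j _ => ?_
  exact (congrArg (· * psi m j x) (fourierCoeff_partialSum hm n g j)).trans (ite_zero_mul ..)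

end PartialSums

section Approximation

variable {m : ℕ → ℕ} [∀ k, NeZero (m k)]

theorem integral_dirichletKernel (hm : ∀ k, 2 ≤ m k) {n : ℕ} (hn : 0 < n) :
    ∫ x, dirichletKernel m n x ∂haar m = 1 := by
  have hpsi : ∀ k, ∫ x, psi m k x ∂haar m = if k = 0 then 1 else 0 := fun k => by
    rw [← fourierCoeff_psi hm k 0]
    simp [fourierCoeff, psi_zero]
  simp only [dirichletKernel]
  rw [integral_finsetSum _ fun k _ => (memLp_psi k 1).integrable le_rfl]
  simp [hpsi, hn]

theorem eq_zero_of_dirichletKernel_ne_zero (hm : ∀ k, 2 ≤ m k) {N : ℕ} {x : VilenkinGroup m}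
    (h : dirichletKernel m (genPow m N) x ≠ 0) : ∀ k < N, x k = 0 := by
  induction N with
  | zero => simp
  | succ N ih =>
    rw [genPow_succ, dirichletKernel_mul hm le_rfl, sum_rademacher_pow] at h
    intro k hk
    rcases Nat.lt_succ_iff_lt_or_eq.1 hk with hk | rfl
    · exact ih (right_ne_zero_of_mul h) k hk
    · by_contra hx
      simp [hx] at h

theorem val_div_genPow_succ_le (x : VilenkinGroup m) (k : ℕ) :
    ((x k).val : ℝ) / genPow m (k + 1) ≤ 1 / genPow m k - 1 / genPow m (k + 1) := by
  have hval : ((x k).val : ℝ) + 1 ≤ m k := by exact_mod_cast ZMod.val_lt (x k)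
  have hm : (0 : ℝ) < m k := by exact_mod_cast NeZero.pos (m k)
  have hM : (0 : ℝ) < genPow m k := by exact_mod_cast genPow_pos k
  rw [le_sub_iff_add_le, ← add_div, genPow_succ, Nat.cast_mul, ← one_div_mul_cancel hm.ne']
  field_simp
  exact hval

theorem absVal_le {N : ℕ} {x : VilenkinGroup m} (h : ∀ k < N, x k = 0) :
    absVal m x ≤ 1 / genPow m N := by
  have hterm : ∀ k, 0 ≤ ((x k).val : ℝ) / (genPow m (k + 1) : ℝ) := fun k => by positivity
  refine Real.tsum_le_of_sum_range_le hterm fun n => ?_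
  calc ∑ k ∈ Finset.range n, ((x k).val : ℝ) / genPow m (k + 1)
      ≤ ∑ k ∈ Finset.range (N + n), ((x k).val : ℝ) / genPow m (k + 1) :=
        Finset.sum_le_sum_of_subset_of_nonneg (Finset.range_mono (Nat.le_add_left n N))
          fun k _ _ => hterm k
    _ = ∑ k ∈ Finset.range n, ((x (N + k)).val : ℝ) / genPow m (N + k + 1) := by
        rw [Finset.sum_range_add, Finset.sum_eq_zero, zero_add]
        intro k hk
        simp [h k (Finset.mem_range.1 hk)]
    _ ≤ ∑ k ∈ Finset.range n, (1 / genPow m (N + k) - 1 / genPow m (N + (k + 1)) : ℝ) :=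
        Finset.sum_le_sum fun k _ => val_div_genPow_succ_le x (N + k)
    _ = 1 / genPow m N - 1 / genPow m (N + n) :=
        Finset.sum_range_sub' (fun k => (1 / genPow m (N + k) : ℝ)) n
    _ ≤ 1 / genPow m N := sub_le_self _ (by positivity)

theorem partialSum_sub_self_eq_integral (hm : ∀ k, 2 ≤ m k) {f : VilenkinGroup m → ℂ}
    (hf : Integrable f (haar m)) {n : ℕ} (hn : 0 < n) (x : VilenkinGroup m) :
    partialSum m n f x - f x = ∫ t, dirichletKernel m n t * (f (x - t) - f x) ∂haar m := by
  simp_rw [mul_sub]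
  rw [integral_sub (integrable_dirichletKernel_mul (hf.comp_sub_left x) n)
    (integrable_dirichletKernel_mul (integrable_const _) n), ← partialSum_eq_integral hf,
    integral_mul_const, integral_dirichletKernel hm hn, one_mul]

theorem eLpNorm_partialSum_genPow_sub_le (hm : ∀ k, 2 ≤ m k) {p : ℝ≥0∞} (hp : 1 ≤ p)
    {f : VilenkinGroup m → ℂ} (hf : MemLp f p (haar m)) (N : ℕ) :
    eLpNorm (fun x => partialSum m (genPow m N) f x - f x) p (haar m) ≤
      modulus m p (2 / genPow m N) f := by
  have hdiff : AEStronglyMeasurable (fun z : VilenkinGroup m × VilenkinGroup m =>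
      f (z.1 - z.2) - f z.1) ((haar m).prod (haar m)) :=
    (aestronglyMeasurable_comp_sub hf.1).sub hf.1.comp_fst
  have hmodulus : ∀ t, dirichletKernel m (genPow m N) t ≠ 0 →
      eLpNorm (fun x => f (x - t) - f x) p (haar m) ≤ modulus m p (2 / genPow m N) f := by
    intro t ht
    have hpos : (0 : ℝ) < genPow m N := by exact_mod_cast genPow_pos N
    have ht_lt : absVal m t < 2 / genPow m N :=
      (absVal_le (eq_zero_of_dirichletKernel_ne_zero hm ht)).trans_lt (by gcongr; norm_num)
    exact le_iSup₂_of_le t ht_lt le_rfl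
  rw [funext (partialSum_sub_self_eq_integral hm (hf.integrable hp) (genPow_pos N))]
  refine (eLpNorm_integral_smul_le hp hdiff (measurable_dirichletKernel _).aestronglyMeasurable
    hmodulus).trans_eq ?_
  rw [eLpNorm_dirichletKernel_genPow hm, mul_one]

end Approximation

end Vilenkin

theorem exists_forall_le_ofReal_mul_of_eventually {u : ℕ → ℝ≥0∞} {v : ℕ → ℝ} {C : ℝ}
    (hu : ∀ n, u n ≠ ∞) (hv : ∀ n, 0 < v n) (h : ∀ᶠ n in atTop, u n ≤ ENNReal.ofReal (C * v n)) :
    ∃ C', 0 ≤ C' ∧ ∀ n, u n ≤ ENNReal.ofReal (C' * v n) := by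
  have hO : (fun n => (u n).toReal) =O[atTop] v := by
    refine IsBigO.of_bound |C| (h.mono fun n hn => ?_)
    rw [Real.norm_of_nonneg ENNReal.toReal_nonneg, Real.norm_of_nonneg (hv n).le]
    refine ENNReal.toReal_le_of_le_ofReal (mul_nonneg (abs_nonneg C) (hv n).le)
      (hn.trans (ENNReal.ofReal_le_ofReal ?_))
    exact mul_le_mul_of_nonneg_right (le_abs_self C) (hv n).le
  obtain ⟨C', hC', hbound⟩ := bound_of_isBigO_nat_atTop hO
  refine ⟨C', hC'.le, fun n => ?_⟩
  have hn := hbound (hv n).ne'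
  rw [Real.norm_of_nonneg ENNReal.toReal_nonneg, Real.norm_of_nonneg (hv n).le] at hn
  exact (ENNReal.le_ofReal_iff_toReal_le (hu n) (mul_nonneg hC'.le (hv n).le)).2 hn

namespace Vilenkin

section FejerError

variable {m : ℕ → ℕ}

theorem tendsto_genPow_atTop (hm : ∀ k, 2 ≤ m k) : Tendsto (genPow m) atTop atTop :=
  tendsto_atTop_mono (fun N => (lt_genPow hm N).le) tendsto_id

variable [∀ k, NeZero (m k)]

theorem MemLip.exists_eLpNorm_partialSum_genPow_sub_le (hm : ∀ k, 2 ≤ m k) {p : ℝ≥0∞} (hp : 1 ≤ p)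
    {α : ℝ} {f : VilenkinGroup m → ℂ} (hf : MemLip m α p f) :
    ∃ C : ℝ, 0 ≤ C ∧ ∀ N, eLpNorm (fun x => partialSum m (genPow m N) f x - f x) p (haar m) ≤
      ENNReal.ofReal (C * (genPow m N : ℝ) ^ (-α)) := by
  obtain ⟨hfp, C, hC⟩ := hf
  have hpos : ∀ N, (0 : ℝ) < genPow m N := fun N => by exact_mod_cast genPow_pos N
  have hδ : Tendsto (fun N => 2 / (genPow m N : ℝ)) atTop (𝓝[>] 0) :=
    tendsto_nhdsWithin_iff.2 ⟨(tendsto_natCast_atTop_atTop.comp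
      (tendsto_genPow_atTop hm)).const_div_atTop 2, .of_forall fun N => div_pos two_pos (hpos N)⟩
  refine exists_forall_le_ofReal_mul_of_eventually (C := C * 2 ^ α)
    (fun N => ((memLp_partialSum _ f p).sub hfp).eLpNorm_ne_top)
    (fun N => Real.rpow_pos_of_pos (hpos N) _) ?_
  filter_upwards [hδ.eventually hC] with N hN
  refine (eLpNorm_partialSum_genPow_sub_le hm hp hfp N).trans (hN.trans_eq ?_)
  rw [Real.div_rpow two_pos.le (hpos N).le, Real.rpow_neg (hpos N).le, div_eq_mul_inv, mul_assoc]

theorem sum_partialSum_sub (hm : ∀ k, 2 ≤ m k) {f : VilenkinGroup m → ℂ}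
    (hf : Integrable f (haar m)) {M n : ℕ} (h : M ≤ n) (x : VilenkinGroup m) :
    ∑ k ∈ Finset.range n, (partialSum m k f x - f x) =
      ∑ k ∈ Finset.range M, (partialSum m k f x - f x) +
        (((n - M : ℕ) : ℂ) * (partialSum m M f x - f x) -
          ∑ k ∈ Finset.range n, partialSum m k (fun y => partialSum m M f y - f y) x) := by
  have hS := (memLp_partialSum (m := m) M f 1).integrable le_rfl
  have hlow : ∀ k ∈ Finset.range M, partialSum m k (fun y => partialSum m M f y - f y) x = 0 :=
    fun k hk => by
      rw [partialSum_sub hS hf, partialSum_partialSum hm, min_eq_left (Finset.mem_range.1 hk).le,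
        sub_self]
  have hhigh : ∀ k, partialSum m (M + k) (fun y => partialSum m M f y - f y) x =
      partialSum m M f x - partialSum m (M + k) f x := fun k => by
    rw [partialSum_sub hS hf, partialSum_partialSum hm, min_eq_right (Nat.le_add_right M k)]
  obtain ⟨d, rfl⟩ := Nat.exists_eq_add_of_le h
  simp only [Finset.sum_range_add, Finset.sum_eq_zero hlow, hhigh, Finset.sum_sub_distrib,
    Finset.sum_const, Finset.card_range, nsmul_eq_mul, Nat.add_sub_cancel_left, Nat.cast_add]
  ring

theorem eLpNorm_sum_partialSum_sub_le_add (hm : ∀ k, 2 ≤ m k) {A : ℕ} (hA : ∀ k, m k ≤ A)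
    {p : ℝ≥0∞} (hp : 1 ≤ p) {f : VilenkinGroup m → ℂ} (hf : MemLp f p (haar m)) {M n : ℕ}
    (h : M ≤ n) :
    eLpNorm (fun x => ∑ k ∈ Finset.range n, (partialSum m k f x - f x)) p (haar m) ≤
      eLpNorm (fun x => ∑ k ∈ Finset.range M, (partialSum m k f x - f x)) p (haar m) +
        5 * A * n * eLpNorm (fun x => partialSum m M f x - f x) p (haar m) := by
  have he : MemLp (fun x => partialSum m M f x - f x) p (haar m) :=
    (memLp_partialSum M f p).sub hf
  have hsum : MemLp (fun x => ∑ k ∈ Finset.range n,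
      partialSum m k (fun y => partialSum m M f y - f y) x) p (haar m) :=
    memLp_finsetSum _ fun k _ => memLp_partialSum k _ p
  have hM : MemLp (fun x => ∑ k ∈ Finset.range M, (partialSum m k f x - f x)) p (haar m) :=
    memLp_finsetSum _ fun k _ => (memLp_partialSum k f p).sub hf
  have hA1 : (1 : ℝ≥0∞) ≤ A := by exact_mod_cast one_le_two.trans ((hm 0).trans (hA 0))
  have hnM : ((n - M : ℕ) : ℝ≥0∞) ≤ A * n :=
    (Nat.cast_le.2 (Nat.sub_le n M)).trans (le_mul_of_one_le_left' hA1)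
  rw [funext (sum_partialSum_sub hm (hf.integrable hp) h)]
  refine (eLpNorm_add_le hM.1 ((he.const_mul _).sub hsum).1 hp).trans (add_le_add_right ?_ _)
  refine (eLpNorm_sub_le (he.const_mul _).1 hsum.1 hp).trans ?_
  rw [eLpNorm_natCast_mul]
  refine (add_le_add (mul_le_mul_left hnM _)
    (eLpNorm_sum_partialSum_le hm hA hp he n)).trans_eq ?_
  ring

theorem MemLip.exists_eLpNorm_sum_partialSum_sub_le_add (hm : ∀ k, 2 ≤ m k) {A : ℕ}
    (hA : ∀ k, m k ≤ A) {p : ℝ≥0∞} (hp : 1 ≤ p) {α : ℝ} {f : VilenkinGroup m → ℂ}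
    (hf : MemLip m α p f) :
    ∃ C : ℝ, 0 ≤ C ∧ ∀ N n, genPow m N ≤ n → n ≤ genPow m (N + 1) →
      eLpNorm (fun x => ∑ k ∈ Finset.range n, (partialSum m k f x - f x)) p (haar m) ≤
        eLpNorm (fun x => ∑ k ∈ Finset.range (genPow m N), (partialSum m k f x - f x)) p (haar m) +
          ENNReal.ofReal (C * (genPow m N : ℝ) ^ (1 - α)) := by
  obtain ⟨C, hC0, hC⟩ := hf.exists_eLpNorm_partialSum_genPow_sub_le hm hp
  refine ⟨5 * A * A * C, by positivity, fun N n hNn hnN => ?_⟩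
  have hpos : (0 : ℝ) < genPow m N := by exact_mod_cast genPow_pos N
  have hn : (n : ℝ≥0∞) ≤ A * genPow m N := by
    exact_mod_cast hnN.trans (Nat.mul_le_mul_right _ (hA N))
  refine (eLpNorm_sum_partialSum_sub_le_add hm hA hp hf.1 hNn).trans (add_le_add_right ?_ _)
  calc 5 * A * n * eLpNorm (fun x => partialSum m (genPow m N) f x - f x) p (haar m)
      ≤ (5 * A * (A * genPow m N) : ℝ≥0∞) * ENNReal.ofReal (C * (genPow m N : ℝ) ^ (-α)) := by
        gcongr
        exact hC N
    _ = ((5 * A * (A * genPow m N) : ℕ) : ℝ≥0∞) *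
          ENNReal.ofReal (C * (genPow m N : ℝ) ^ (-α)) := by push_cast; rfl
    _ = ENNReal.ofReal (5 * A * A * C * (genPow m N : ℝ) ^ (1 - α)) := by
        rw [← ENNReal.ofReal_natCast, ← ENNReal.ofReal_mul (by positivity), sub_eq_add_neg,
          Real.rpow_add hpos, Real.rpow_one]
        push_cast
        ring_nf

theorem genPow_succ_rpow_le (hm : ∀ k, 2 ≤ m k) {α : ℝ} (hα : 0 ≤ α) (N : ℕ) :
    (genPow m (N + 1) : ℝ) ^ (1 - α) ≤
      2 * ∑ k ∈ Finset.Ico (genPow m N) (genPow m (N + 1)), ((k : ℝ) + 1) ^ (-α) := by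
  set M := genPow m N
  set M' := genPow m (N + 1)
  have hpos : (0 : ℝ) < M' := by exact_mod_cast genPow_pos (N + 1)
  have hMM' : 2 * M ≤ M' := (Nat.mul_le_mul_right M (hm N)).trans_eq (genPow_succ N).symm
  have hcard : (M' : ℝ) ≤ 2 * (M' - M : ℕ) := by exact_mod_cast (by omega : M' ≤ 2 * (M' - M))
  calc (M' : ℝ) ^ (1 - α) = M' * (M' : ℝ) ^ (-α) := by
        rw [sub_eq_add_neg, Real.rpow_add hpos, Real.rpow_one]
    _ ≤ 2 * (M' - M : ℕ) * (M' : ℝ) ^ (-α) := by gcongr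
    _ = 2 * ∑ _ ∈ Finset.Ico M M', (M' : ℝ) ^ (-α) := by
        rw [Finset.sum_const, Nat.card_Ico, nsmul_eq_mul, mul_assoc]
    _ ≤ 2 * ∑ k ∈ Finset.Ico M M', ((k : ℝ) + 1) ^ (-α) := by
        gcongr 2 * ?_
        refine Finset.sum_le_sum fun k hk => ?_
        refine Real.rpow_le_rpow_of_nonpos (by positivity) ?_ (neg_nonpos.2 hα)
        exact_mod_cast (Finset.mem_Ico.1 hk).2

theorem sum_genPow_rpow_le (hm : ∀ k, 2 ≤ m k) {α : ℝ} (hα : 0 ≤ α) (N : ℕ) :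
    ∑ j ∈ Finset.range (N + 1), (genPow m j : ℝ) ^ (1 - α) ≤
      2 * ∑ k ∈ Finset.range (genPow m N), ((k : ℝ) + 1) ^ (-α) := by
  induction N with
  | zero => norm_num [genPow]
  | succ N ih =>
    rw [Finset.sum_range_succ,
      ← Finset.sum_range_add_sum_Ico _ (genPow_mono (Nat.le_succ N)), mul_add]
    exact add_le_add ih (genPow_succ_rpow_le hm hα N)

theorem MemLip.exists_eLpNorm_sum_partialSum_sub_le_mul_sum_genPow (hm : ∀ k, 2 ≤ m k)
    (hbdd : BddAbove (Set.range m)) {p : ℝ≥0∞} (hp : 1 ≤ p) {α : ℝ} {f : VilenkinGroup m → ℂ}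
    (hf : MemLip m α p f) :
    ∃ C : ℝ, 0 ≤ C ∧ ∀ N n, genPow m N ≤ n → n ≤ genPow m (N + 1) →
      eLpNorm (fun x => ∑ k ∈ Finset.range n, (partialSum m k f x - f x)) p (haar m) ≤
        ENNReal.ofReal (C * ∑ j ∈ Finset.range (N + 1), (genPow m j : ℝ) ^ (1 - α)) := by
  obtain ⟨A, hA⟩ := hbdd
  obtain ⟨C, hC0, hC⟩ := hf.exists_eLpNorm_sum_partialSum_sub_le_add hm
    (fun k => hA (Set.mem_range_self k)) hp
  set F := (eLpNorm f p (haar m)).toReal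
  have hF0 : 0 ≤ F := ENNReal.toReal_nonneg
  refine ⟨F + C, by positivity, fun N => ?_⟩
  induction N with
  | zero =>
    intro n hn hn'
    have hneg : (fun x => ∑ k ∈ Finset.range (genPow m 0), (partialSum m k f x - f x)) = -f := by
      ext x
      simp [genPow, partialSum]
    refine (hC 0 n hn hn').trans_eq ?_
    rw [hneg, eLpNorm_neg, zero_add, Finset.sum_range_one, add_mul,
      ENNReal.ofReal_add (by positivity) (by positivity), genPow, Nat.cast_one, Real.one_rpow,
      mul_one, mul_one, ENNReal.ofReal_toReal hf.1.eLpNorm_ne_top]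
  | succ N ih =>
    intro n hn hn'
    rw [Finset.sum_range_succ, mul_add, ENNReal.ofReal_add (by positivity) (by positivity)]
    refine (hC _ n hn hn').trans (add_le_add (ih _ (genPow_mono (Nat.le_succ N)) le_rfl) ?_)
    gcongr
    exact le_add_of_nonneg_left hF0

theorem MemLip.exists_eLpNorm_sum_partialSum_sub_le (hm : ∀ k, 2 ≤ m k)
    (hbdd : BddAbove (Set.range m)) {p : ℝ≥0∞} (hp : 1 ≤ p) {α : ℝ} (hα : 0 ≤ α)
    {f : VilenkinGroup m → ℂ} (hf : MemLip m α p f) :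
    ∃ C : ℝ, 0 ≤ C ∧ ∀ n,
      eLpNorm (fun x => ∑ k ∈ Finset.range n, (partialSum m k f x - f x)) p (haar m) ≤
        ENNReal.ofReal (C * ∑ k ∈ Finset.range n, ((k : ℝ) + 1) ^ (-α)) := by
  obtain ⟨C, hC0, hC⟩ := hf.exists_eLpNorm_sum_partialSum_sub_le_mul_sum_genPow hm hbdd hp
  refine ⟨C * 2, by positivity, fun n => ?_⟩
  rcases n.eq_zero_or_pos with rfl | hn
  · simp
  obtain ⟨N, hNn, hnN⟩ := exists_genPow_le_lt hm hn
  refine (hC N n hNn hnN.le).trans (ENNReal.ofReal_le_ofReal ?_)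
  rw [mul_assoc]
  refine mul_le_mul_of_nonneg_left ((sum_genPow_rpow_le hm hα N).trans ?_) hC0
  gcongr

end FejerError

end Vilenkin

theorem eLpNorm_sum_smul_le_of_antitone {X E : Type*} [MeasurableSpace X] [NormedAddCommGroup E]
    [NormedSpace ℝ E] {μ : Measure X} {p : ℝ≥0∞} (hp : 1 ≤ p) {q w : ℕ → ℝ} (hq : Antitone q)
    (hq0 : ∀ k, 0 ≤ q k) (hw : ∀ k, 0 ≤ w k) {b : ℕ → X → E}
    (hb : ∀ k, AEStronglyMeasurable (b k) μ)
    (hbw : ∀ n, eLpNorm (∑ k ∈ Finset.range n, b k) p μ ≤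
      ENNReal.ofReal (∑ k ∈ Finset.range n, w k)) (n : ℕ) :
    eLpNorm (∑ k ∈ Finset.range n, q k • b k) p μ ≤
      ENNReal.ofReal (∑ k ∈ Finset.range n, q k * w k) := by
  have hmeas : ∀ (c : ℕ → ℝ) n, AEStronglyMeasurable (∑ k ∈ Finset.range n, c k • b k) μ :=
    fun c n => Finset.aestronglyMeasurable_sum _ fun k _ => (hb k).const_smul _
  -- Allowing a constant to be subtracted from the weights is what makes the induction close.
  suffices ∀ n c, c ≤ q n → eLpNorm (∑ k ∈ Finset.range n, (q k - c) • b k) p μ ≤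
      ENNReal.ofReal (∑ k ∈ Finset.range n, (q k - c) * w k) by
    simpa only [sub_zero] using this n 0 (hq0 n)
  intro n
  induction n with
  | zero => simp
  | succ n ih =>
    intro c hc
    have hqc : 0 ≤ q n - c := sub_nonneg.2 (hc.trans (hq (Nat.le_succ n)))
    have hsplit : ∑ k ∈ Finset.range (n + 1), (q k - c) • b k =
        ∑ k ∈ Finset.range n, (q k - q n) • b k +
          (q n - c) • ∑ k ∈ Finset.range (n + 1), b k := by
      simp only [sub_smul, Finset.sum_sub_distrib, ← Finset.smul_sum, Finset.sum_range_succ]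
      module
    have hsplit' : ∑ k ∈ Finset.range (n + 1), (q k - c) * w k =
        ∑ k ∈ Finset.range n, (q k - q n) * w k +
          (q n - c) * ∑ k ∈ Finset.range (n + 1), w k := by
      simp only [sub_mul, Finset.sum_sub_distrib, ← Finset.mul_sum, Finset.sum_range_succ]
      ring
    have hfirst : 0 ≤ ∑ k ∈ Finset.range n, (q k - q n) * w k := Finset.sum_nonneg fun k hk =>
      mul_nonneg (sub_nonneg.2 (hq (Finset.mem_range.1 hk).le)) (hw k)
    rw [hsplit, hsplit', ENNReal.ofReal_add hfirst (mul_nonneg hqc (Finset.sum_nonneg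
      fun k _ => hw k)), ENNReal.ofReal_mul hqc]
    refine (eLpNorm_add_le (hmeas (fun k => q k - q n) n) ((Finset.aestronglyMeasurable_sum _
      fun k _ => hb k).const_smul _) hp).trans (add_le_add (ih (q n) le_rfl) ?_)
    rw [eLpNorm_const_smul, Real.enorm_of_nonneg hqc]
    exact mul_le_mul_right (hbw (n + 1)) _

namespace Vilenkin

section Weights

variable {q : ℕ → ℝ}

theorem weightSum_pos (hq : ∀ k, 0 ≤ q k) (hq0 : 0 < q 0) {n : ℕ} (hn : 0 < n) :
    0 < weightSum q n :=
  Finset.sum_pos' (fun k _ => hq k) ⟨0, Finset.mem_range.2 hn, hq0⟩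

theorem natCast_mul_le_weightSum (hq : Antitone q) (n : ℕ) : n * q n ≤ weightSum q n := by
  have h := Finset.card_nsmul_le_sum (Finset.range n) q (q n) fun k hk =>
    hq (Finset.mem_range.1 hk).le
  rwa [Finset.card_range, nsmul_eq_mul] at h

theorem inv_weightSum_isBigO (hq : Antitone q) (hq0 : ∀ k, 0 ≤ q k) {β : ℝ}
    (h : (fun k : ℕ => Real.log k ^ (-β)) =O[atTop] q) :
    (fun n => (weightSum q n)⁻¹) =O[atTop] fun n : ℕ => (n : ℝ)⁻¹ * Real.log n ^ β := by
  have hle : (fun n : ℕ => n * q n) =O[atTop] weightSum q := .of_norm_le fun n => by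
    rw [Real.norm_of_nonneg (mul_nonneg n.cast_nonneg (hq0 n))]
    exact natCast_mul_le_weightSum hq n
  have hmul : (fun n : ℕ => (n : ℝ) * Real.log n ^ (-β)) =O[atTop] weightSum q :=
    ((isBigO_refl _ _).mul h).trans hle
  refine (hmul.inv_rev ?_).congr_right fun n => ?_
  · filter_upwards [eventually_ge_atTop 2] with n hn h0
    have hn' : (1 : ℝ) < n := by exact_mod_cast hn
    have := Real.rpow_pos_of_pos (Real.log_pos hn') (-β)
    exact absurd h0 (by positivity)
  · rw [mul_inv, Real.rpow_neg (Real.log_natCast_nonneg n), inv_inv]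

theorem apply_zero_pos_of_isBigO (hq : Antitone q) (hq0 : ∀ k, 0 ≤ q k) {β : ℝ}
    (h : (fun k : ℕ => Real.log k ^ (-β)) =O[atTop] q) : 0 < q 0 := by
  obtain ⟨n, hn, hn2⟩ := (h.eq_zero_imp.and (eventually_ge_atTop 2)).exists
  have hlog : Real.log n ^ (-β) ≠ 0 :=
    (Real.rpow_pos_of_pos (Real.log_pos (by exact_mod_cast hn2)) _).ne'
  exact ((hq0 n).lt_of_ne' (mt hn hlog)).trans_le (hq n.zero_le)

end Weights

section Means

variable {m : ℕ → ℕ} [∀ k, NeZero (m k)]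

theorem tMean_sub_self {q : ℕ → ℝ} {n : ℕ} (hn : weightSum q n ≠ 0) (f : VilenkinGroup m → ℂ) :
    (fun x => tMean m q n f x - f x) =
      (weightSum q n)⁻¹ • ∑ k ∈ Finset.range n, q k • fun x => partialSum m k f x - f x := by
  ext x
  have hn' : (weightSum q n : ℂ) ≠ 0 := by exact_mod_cast hn
  have hsum : ∑ k ∈ Finset.range n, (q k : ℂ) = weightSum q n := (Complex.ofReal_sum _ _).symm
  simp only [tMean, Pi.smul_apply, Finset.sum_apply, Complex.real_smul, mul_sub,
    Finset.sum_sub_distrib, ← Finset.sum_mul, hsum, one_div, Complex.ofReal_inv]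
  rw [inv_mul_cancel_left₀ hn']

theorem MemLip.tError_isBigO (hm : ∀ k, 2 ≤ m k) (hbdd : BddAbove (Set.range m)) {p : ℝ≥0∞}
    (hp : 1 ≤ p) {α : ℝ} (hα : 0 ≤ α) {f : VilenkinGroup m → ℂ} (hf : MemLip m α p f) {q : ℕ → ℝ}
    (hq : Antitone q) (hq0 : ∀ k, 0 ≤ q k) (hq_pos : 0 < q 0) :
    tError m q p f =O[atTop] fun n =>
      (weightSum q n)⁻¹ * ∑ k ∈ Finset.range n, q k * ((k : ℝ) + 1) ^ (-α) := by
  obtain ⟨C, hC0, hC⟩ := hf.exists_eLpNorm_sum_partialSum_sub_le hm hbdd hp hα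
  refine IsBigO.of_bound C ?_
  filter_upwards [eventually_gt_atTop 0] with n hn
  have hQ := weightSum_pos hq0 hq_pos hn
  have hS : 0 ≤ ∑ k ∈ Finset.range n, q k * ((k : ℝ) + 1) ^ (-α) :=
    Finset.sum_nonneg fun k _ => mul_nonneg (hq0 k) (by positivity)
  have habel := eLpNorm_sum_smul_le_of_antitone hp hq hq0
    (w := fun k => C * ((k : ℝ) + 1) ^ (-α)) (fun k => by positivity)
    (fun k => ((memLp_partialSum k f p).sub hf.1).1)
    (fun n => by rw [← Finset.mul_sum, Finset.sum_fn]; exact hC n) n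
  rw [tError, Real.norm_of_nonneg ENNReal.toReal_nonneg, Real.norm_of_nonneg (by positivity)]
  refine ENNReal.toReal_le_of_le_ofReal (by positivity) ?_
  rw [tMean_sub_self hQ.ne', eLpNorm_const_smul, Real.enorm_of_nonneg (by positivity)]
  refine (mul_le_mul_right habel _).trans_eq ?_
  simp only [mul_left_comm _ C, ← Finset.mul_sum]
  rw [← ENNReal.ofReal_mul (by positivity), mul_left_comm]

end Means

end Vilenkin

section SumAsymptotics

variable {E : Type*} [SeminormedAddCommGroup E]

theorem isBigO_sum_range_of_isBigO_sub {u : ℕ → E} {v : ℕ → ℝ}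
    (h : (fun n => u (n + 1)) =O[atTop] fun n => v (n + 1) - v n)
    (hmono : ∀ᶠ n in atTop, v n ≤ v (n + 1)) (hv : Tendsto v atTop atTop) :
    (fun n => ∑ k ∈ Finset.range n, u k) =O[atTop] v := by
  obtain ⟨C, hC0, hC⟩ := h.exists_nonneg
  obtain ⟨K, hK⟩ := eventually_atTop.1 (hC.bound.and hmono)
  set B := ∑ k ∈ Finset.range (K + 1), ‖u k‖
  have htelescope : ∀ n ≥ K, ∑ k ∈ Finset.range (n + 1), ‖u k‖ ≤ B + C * (v n - v K) := by
    intro n hn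
    induction n, hn using Nat.le_induction with
    | base => simp [B]
    | succ n hn ih =>
      have hstep := (hK n hn).1
      rw [Real.norm_of_nonneg (sub_nonneg.2 (hK n hn).2)] at hstep
      rw [Finset.sum_range_succ]
      linarith
  refine IsBigO.of_bound (1 + C) ?_
  filter_upwards [eventually_ge_atTop K, hv.eventually_ge_atTop (B + C * |v K|)] with n hn hvn
  have hvn0 : 0 ≤ v n := le_trans (by positivity) hvn
  rw [Real.norm_of_nonneg hvn0]
  calc ‖∑ k ∈ Finset.range n, u k‖ ≤ ∑ k ∈ Finset.range n, ‖u k‖ := norm_sum_le _ _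
    _ ≤ ∑ k ∈ Finset.range (n + 1), ‖u k‖ := by simp [Finset.sum_range_succ]
    _ ≤ (1 + C) * v n := by
      linarith [htelescope n hn, mul_le_mul_of_nonneg_left (neg_le_abs (v K)) hC0]

theorem isBigO_sum_range_of_hasDerivAt {u : ℕ → E} {g G G' : ℝ → ℝ} {a : ℝ}
    (hu : u =O[atTop] fun n : ℕ => g n) (hg : AntitoneOn g (Set.Ioi a)) (hg0 : 0 ≤ᶠ[atTop] g)
    (hgG : g ≤ᶠ[atTop] G') (hG : ∀ᶠ x in atTop, HasDerivAt G (G' x) x)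
    (hG_top : Tendsto G atTop atTop) :
    (fun n => ∑ k ∈ Finset.range n, u k) =O[atTop] fun n : ℕ => G n := by
  obtain ⟨b, hb⟩ := eventually_atTop.1 (hgG.and hG)
  have hincr : ∀ᶠ x in atTop, g (x + 1) ≤ G (x + 1) - G x := by
    filter_upwards [eventually_gt_atTop a, eventually_ge_atTop b] with x hax hbx
    have hderiv : ∀ y ≥ x, HasDerivAt G (G' y) y := fun y hy => (hb y (hbx.trans hy)).2
    obtain ⟨ξ, ⟨hxξ, hξx⟩, hξ⟩ := exists_hasDerivAt_eq_slope G G' (lt_add_one x)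
      (fun y hy => (hderiv y hy.1).continuousAt.continuousWithinAt)
      fun y hy => hderiv y hy.1.le
    rw [add_sub_cancel_left, div_one] at hξ
    rw [← hξ]
    exact (hg (hax.trans hxξ) (hax.trans (lt_add_one x)) hξx.le).trans
      (hb ξ (hbx.trans hxξ.le)).1
  have hcast := tendsto_natCast_atTop_atTop (R := ℝ)
  have hsucc := hcast.comp (tendsto_add_atTop_nat 1)
  have hu' : (fun n => u (n + 1)) =O[atTop] fun n : ℕ => g ((n + 1 : ℕ) : ℝ) :=
    hu.comp_tendsto (tendsto_add_atTop_nat 1)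
  have hg_incr : ∀ᶠ n : ℕ in atTop, 0 ≤ g ((n + 1 : ℕ) : ℝ) ∧
      g ((n + 1 : ℕ) : ℝ) ≤ G ((n + 1 : ℕ) : ℝ) - G n := by
    filter_upwards [hsucc.eventually hg0, hcast.eventually hincr] with n h0 hn
    exact ⟨h0, by rwa [Nat.cast_succ]⟩
  refine isBigO_sum_range_of_isBigO_sub (hu'.trans (IsBigO.of_bound' ?_)) ?_ (hG_top.comp hcast)
  · filter_upwards [hg_incr] with n hn
    rw [Real.norm_of_nonneg hn.1]
    exact hn.2.trans (le_abs_self _)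
  · filter_upwards [hg_incr] with n hn
    exact sub_nonneg.1 (hn.1.trans hn.2)

theorem antitoneOn_rpow_neg_mul_log_rpow_neg {α β : ℝ} (hα : 0 ≤ α) (hβ : 0 ≤ β) :
    AntitoneOn (fun x : ℝ => x ^ (-α) * Real.log x ^ (-β)) (Set.Ioi 1) := by
  intro x hx y hy hxy
  have hx0 : 0 < x := one_pos.trans hx
  exact mul_le_mul (Real.rpow_le_rpow_of_nonpos hx0 hxy (neg_nonpos.2 hα))
    (Real.rpow_le_rpow_of_nonpos (Real.log_pos hx) (Real.log_le_log hx0 hxy) (neg_nonpos.2 hβ))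
    (Real.rpow_nonneg (Real.log_pos hy).le _) (Real.rpow_nonneg hx0.le _)

theorem rpow_neg_mul_log_rpow_neg_nonneg (α β : ℝ) :
    0 ≤ᶠ[atTop] fun x : ℝ => x ^ (-α) * Real.log x ^ (-β) := by
  filter_upwards [eventually_ge_atTop 1] with x hx
  exact mul_nonneg (Real.rpow_nonneg (zero_le_one.trans hx) _)
    (Real.rpow_nonneg (Real.log_nonneg hx) _)

theorem tendsto_rpow_mul_log_rpow_neg_atTop {γ : ℝ} (hγ : 0 < γ) (β : ℝ) :
    Tendsto (fun x : ℝ => x ^ γ * Real.log x ^ (-β)) atTop atTop := by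
  have hzero : Tendsto (fun x : ℝ => Real.log x ^ β / x ^ γ) atTop (𝓝[>] 0) := by
    refine tendsto_nhdsWithin_iff.2
      ⟨(isLittleO_log_rpow_rpow_atTop β hγ).tendsto_div_nhds_zero, ?_⟩
    filter_upwards [eventually_gt_atTop 1] with x hx
    exact div_pos (Real.rpow_pos_of_pos (Real.log_pos hx) _)
      (Real.rpow_pos_of_pos (one_pos.trans hx) _)
  refine hzero.inv_tendsto_nhdsGT_zero.congr' ?_
  filter_upwards [eventually_ge_atTop 1] with x hx
  rw [Pi.inv_apply, inv_div, Real.rpow_neg (Real.log_nonneg hx), div_eq_mul_inv]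

variable {u : ℕ → E} {α β : ℝ}

theorem isBigO_sum_range_of_lt_one (hα : 0 ≤ α) (hα1 : α < 1) (hβ : 0 ≤ β)
    (hu : u =O[atTop] fun n : ℕ => (n : ℝ) ^ (-α) * Real.log n ^ (-β)) :
    (fun n => ∑ k ∈ Finset.range n, u k) =O[atTop]
      fun n : ℕ => (n : ℝ) ^ (1 - α) * Real.log n ^ (-β) := by
  have hα' : 0 < 1 - α := sub_pos.2 hα1
  have hderiv : ∀ᶠ x in atTop, HasDerivAt
      (fun x : ℝ => 2 / (1 - α) * (x ^ (1 - α) * Real.log x ^ (-β)))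
      (2 / (1 - α) * (1 - α - β / Real.log x) * (x ^ (-α) * Real.log x ^ (-β))) x := by
    filter_upwards [eventually_gt_atTop 1] with x hx
    have hx0 : 0 < x := one_pos.trans hx
    have hlog := Real.log_pos hx
    refine (((Real.hasDerivAt_rpow_const (p := 1 - α) (Or.inl hx0.ne')).mul
      ((Real.hasDerivAt_log hx0.ne').rpow_const (p := -β) (Or.inl hlog.ne'))).const_mul
      (2 / (1 - α))).congr_deriv ?_
    rw [show 1 - α - 1 = -α by ring, show 1 - α = -α + 1 by ring, Real.rpow_add_one hx0.ne',
      Real.rpow_sub_one hlog.ne']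
    field_simp
    ring
  have hle : (fun x : ℝ => x ^ (-α) * Real.log x ^ (-β)) ≤ᶠ[atTop] fun x =>
      2 / (1 - α) * (1 - α - β / Real.log x) * (x ^ (-α) * Real.log x ^ (-β)) := by
    have hlim : Tendsto (fun x => β / Real.log x) atTop (𝓝 0) :=
      Real.tendsto_log_atTop.const_div_atTop β
    filter_upwards [hlim.eventually_le_const (half_pos hα'),
      rpow_neg_mul_log_rpow_neg_nonneg α β] with x hx h0
    refine le_mul_of_one_le_left h0 ?_
    rw [div_mul_eq_mul_div, le_div_iff₀ hα']
    linarith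
  exact (isBigO_sum_range_of_hasDerivAt hu (antitoneOn_rpow_neg_mul_log_rpow_neg hα hβ)
    (rpow_neg_mul_log_rpow_neg_nonneg α β) hle hderiv
    ((tendsto_rpow_mul_log_rpow_neg_atTop hα' β).const_mul_atTop (div_pos two_pos hα'))).trans
    (isBigO_const_mul_self _ _ _)

theorem isBigO_sum_range_log_rpow (hβ : 0 ≤ β) (hβ1 : β < 1)
    (hu : u =O[atTop] fun n : ℕ => (n : ℝ) ^ (-1 : ℝ) * Real.log n ^ (-β)) :
    (fun n => ∑ k ∈ Finset.range n, u k) =O[atTop] fun n : ℕ => Real.log n ^ (1 - β) := by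
  have hβ' : 0 < 1 - β := sub_pos.2 hβ1
  have hderiv : ∀ᶠ x in atTop, HasDerivAt (fun x => (1 - β)⁻¹ * Real.log x ^ (1 - β))
      (x ^ (-1 : ℝ) * Real.log x ^ (-β)) x := by
    filter_upwards [eventually_gt_atTop 1] with x hx
    refine (((Real.hasDerivAt_log (one_pos.trans hx).ne').rpow_const (p := 1 - β)
      (Or.inl (Real.log_pos hx).ne')).const_mul (1 - β)⁻¹).congr_deriv ?_
    rw [Real.rpow_neg_one, show 1 - β - 1 = -β by ring]
    field_simp
  exact (isBigO_sum_range_of_hasDerivAt hu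
    (antitoneOn_rpow_neg_mul_log_rpow_neg zero_le_one hβ)
    (rpow_neg_mul_log_rpow_neg_nonneg 1 β) .rfl hderiv
    (((tendsto_rpow_atTop hβ').comp Real.tendsto_log_atTop).const_mul_atTop
      (inv_pos.2 hβ'))).trans (isBigO_const_mul_self _ _ _)

theorem isBigO_sum_range_log_log
    (hu : u =O[atTop] fun n : ℕ => (n : ℝ) ^ (-1 : ℝ) * Real.log n ^ (-1 : ℝ)) :
    (fun n => ∑ k ∈ Finset.range n, u k) =O[atTop] fun n : ℕ => Real.log (Real.log n) := by
  have hderiv : ∀ᶠ x in atTop, HasDerivAt (fun x => Real.log (Real.log x))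
      (x ^ (-1 : ℝ) * Real.log x ^ (-1 : ℝ)) x := by
    filter_upwards [eventually_gt_atTop 1] with x hx
    rw [Real.rpow_neg_one, Real.rpow_neg_one, ← div_eq_mul_inv]
    exact (Real.hasDerivAt_log (one_pos.trans hx).ne').log (Real.log_pos hx).ne'
  exact isBigO_sum_range_of_hasDerivAt hu
    (antitoneOn_rpow_neg_mul_log_rpow_neg zero_le_one zero_le_one)
    (rpow_neg_mul_log_rpow_neg_nonneg 1 1) .rfl hderiv
    (Real.tendsto_log_atTop.comp Real.tendsto_log_atTop)

theorem isBigO_sum_range_one_of_one_lt [CompleteSpace E] (hα : 1 < α) (hβ : 0 ≤ β)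
    (hu : u =O[atTop] fun n : ℕ => (n : ℝ) ^ (-α) * Real.log n ^ (-β)) :
    (fun n => ∑ k ∈ Finset.range n, u k) =O[atTop] fun _ => (1 : ℝ) := by
  have hlog : (fun n : ℕ => Real.log n ^ (-β)) =O[atTop] fun _ => (1 : ℝ) := by
    refine IsBigO.of_bound' ?_
    filter_upwards [tendsto_natCast_atTop_atTop.eventually
      (Real.tendsto_log_atTop.eventually_ge_atTop 1)] with n hn
    rw [norm_one, Real.norm_of_nonneg (Real.rpow_nonneg (zero_le_one.trans hn) _)]
    exact Real.rpow_le_one_of_one_le_of_nonpos hn (neg_nonpos.2 hβ)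
  have hsummable : Summable u := summable_of_isBigO_nat
    (Real.summable_nat_rpow.2 (neg_lt_neg hα))
    (hu.trans (((isBigO_refl _ _).mul hlog).congr_right fun n => mul_one _))
  exact hsummable.hasSum.tendsto_sum_nat.isBigO_one ℝ

end SumAsymptotics

theorem isBigO_mul_add_one_rpow_neg {q v : ℕ → ℝ} (hq : q =O[atTop] v) {α : ℝ} (hα : 0 ≤ α) :
    (fun k : ℕ => q k * ((k : ℝ) + 1) ^ (-α)) =O[atTop] fun k : ℕ => (k : ℝ) ^ (-α) * v k := by
  have hshift : (fun k : ℕ => ((k : ℝ) + 1) ^ (-α)) =O[atTop] fun k : ℕ => (k : ℝ) ^ (-α) := by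
    refine IsBigO.of_norm_eventuallyLE ?_
    filter_upwards [eventually_gt_atTop 0] with k hk
    rw [Real.norm_of_nonneg (by positivity)]
    exact Real.rpow_le_rpow_of_nonpos (Nat.cast_pos.2 hk) (lt_add_one _).le (neg_nonpos.2 hα)
  simpa only [mul_comm] using hq.mul hshift

theorem Vilenkin.MemLip.tError_isBigO_of_isTheta {m : ℕ → ℕ} [∀ k, NeZero (m k)]
    (hm : ∀ k, 2 ≤ m k) (hbdd : BddAbove (Set.range m)) {q : ℕ → ℝ} (hq0 : ∀ k, 0 ≤ q k)
    (hq_anti : Antitone q) {β : ℝ} (hq : q =Θ[atTop] fun k : ℕ => Real.log k ^ (-β)) {α : ℝ}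
    (hα : 0 ≤ α) {p : ℝ≥0∞} (hp : 1 ≤ p) {f : VilenkinGroup m → ℂ} (hf : MemLip m α p f)
    {v : ℕ → ℝ} (hv : (fun n => ∑ k ∈ Finset.range n, q k * ((k : ℝ) + 1) ^ (-α)) =O[atTop] v) :
    tError m q p f =O[atTop] fun n : ℕ => (n : ℝ)⁻¹ * Real.log n ^ β * v n :=
  (hf.tError_isBigO hm hbdd hp hα hq_anti hq0 (apply_zero_pos_of_isBigO hq_anti hq0 hq.2)).trans
    ((inv_weightSum_isBigO hq_anti hq0 hq.2).mul hv)

theorem corollary3_general (m : ℕ → ℕ) [∀ k, NeZero (m k)] (hm : ∀ k, 2 ≤ m k)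
    (hbdd : BddAbove (Set.range m))
    (q : ℕ → ℝ) (hq_nonneg : ∀ k, 0 ≤ q k) (hq_anti : Antitone q)
    (β : ℝ) (hβ : 0 ≤ β)
    (hq : q =Θ[atTop] fun k : ℕ => Real.log k ^ (-β))
    (α : ℝ) (hα : 0 ≤ α) (p : ℝ≥0∞) (hp : 1 ≤ p)
    (f : Vilenkin.VilenkinGroup m → ℂ) (hf : Vilenkin.MemLip m α p f) :
    (α < 1 →
      Vilenkin.tError m q p f =O[atTop] fun n : ℕ => (n : ℝ) ^ (-α)) ∧
    (α = 1 → β < 1 →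
      Vilenkin.tError m q p f =O[atTop] fun n : ℕ => (n : ℝ)⁻¹ * Real.log n) ∧
    (α = 1 → β = 1 →
      Vilenkin.tError m q p f =O[atTop]
        fun n : ℕ => (n : ℝ)⁻¹ * Real.log n * Real.log (Real.log n)) ∧
    (1 < α →
      Vilenkin.tError m q p f =O[atTop] fun n : ℕ => (n : ℝ)⁻¹ * Real.log n ^ β) := by
  have hterm := isBigO_mul_add_one_rpow_neg hq.1 hα
  refine ⟨fun hα1 => ?_, ?_, ?_, fun hα1 => ?_⟩
  · refine (hf.tError_isBigO_of_isTheta hm hbdd hq_nonneg hq_anti hq hα hp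
      (isBigO_sum_range_of_lt_one hα hα1 hβ hterm)).trans_eventuallyEq ?_
    filter_upwards [eventually_ge_atTop 2] with n hn
    have hn1 : (1 : ℝ) < n := by exact_mod_cast hn
    have hlog := (Real.rpow_pos_of_pos (Real.log_pos hn1) β).ne'
    rw [Real.rpow_neg (Real.log_pos hn1).le, sub_eq_neg_add, Real.rpow_add_one (by positivity)]
    field_simp
  · rintro rfl hβ1
    refine (hf.tError_isBigO_of_isTheta hm hbdd hq_nonneg hq_anti hq hα hp
      (isBigO_sum_range_log_rpow hβ hβ1 hterm)).congr_right fun n => ?_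
    rw [mul_assoc, ← Real.rpow_add' (Real.log_natCast_nonneg n) (by simp), add_sub_cancel,
      Real.rpow_one]
  · rintro rfl rfl
    simpa only [Real.rpow_one] using hf.tError_isBigO_of_isTheta hm hbdd hq_nonneg hq_anti hq hα hp
      (isBigO_sum_range_log_log hterm)
  · simpa only [mul_one] using hf.tError_isBigO_of_isTheta hm hbdd hq_nonneg hq_anti hq hα hp
      (isBigO_sum_range_one_of_one_lt hα1 hβ hterm)

theorem corollary3 (m : ℕ → ℕ) [∀ k, NeZero (m k)] (hm : ∀ k, 2 ≤ m k)
    (hbdd : BddAbove (Set.range m))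
    (q : ℕ → ℝ) (hq_nonneg : ∀ k, 0 ≤ q k) (hq_anti : Antitone q)
    (β : ℝ) (hβ : 0 < β)
    (hq : q =Θ[atTop] fun k : ℕ => Real.log k ^ (-β))
    (α : ℝ) (hα : 0 < α) (p : ℝ≥0∞) (hp : 1 ≤ p) (hp_top : p < ∞)
    (f : Vilenkin.VilenkinGroup m → ℂ) (hf : Vilenkin.MemLip m α p f) :
    (α < 1 →
      Vilenkin.tError m q p f =O[atTop] fun n : ℕ => (n : ℝ) ^ (-α)) ∧
    (α = 1 → β < 1 →
      Vilenkin.tError m q p f =O[atTop] fun n : ℕ => (n : ℝ)⁻¹ * Real.log n) ∧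
    (α = 1 → β = 1 →
      Vilenkin.tError m q p f =O[atTop]
        fun n : ℕ => (n : ℝ)⁻¹ * Real.log n * Real.log (Real.log n)) ∧
    (1 < α →
      Vilenkin.tError m q p f =O[atTop] fun n : ℕ => (n : ℝ)⁻¹ * Real.log n ^ β) :=
  corollary3_general m hm hbdd q hq_nonneg hq_anti β hβ.le hq α hα.le p hp f hf
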